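/- **Proposition 1.1.** All vector spaces and tensor products are over $\mathbb{C}$. Let $\mathfrak{g}$ be a simple finite-dimensional Lie algebra with a non-degenerate symmetric invariant bilinear form $(\cdot,\cdot)$, a Cartan subalgebra $\mathfrak{h}$, and a choice of simple roots, and let $\mathfrak{n}^{\pm}$ be the sums of the positive, respectively negative, root spaces. Let $\tau$ be the Lie algebra with underlying space $\mathfrak{g}\otimes\mathbb{C}[t,t^{-1}]\oplus\bigoplus_{n\in\mathbb{Z}}\mathbb{C}L_n\oplus\mathbb{C}K$, in which $K$ is central and $$[X\otimes t^n,Y\otimes t^m]=[X,Y]\otimes t^{m+n}+m\,\delta_{m+n,0}(X,Y)K,\qquad [L_n,X\otimes t^m]=m\,X\otimes t^{m+n},$$ $$[L_n,L_m]=(m-n)L_{n+m}+\delta_{n+m,0}\tfrac{n^3-n}{12}K$$ (the quotient by $\mathbb{C}(K-C_0)$ of the semidirect product of the Virasoro algebra, with centre $\mathbb{C}C_0$, and the affine Lie algebra, with centre $\mathbb{C}K$). Put $\bar{\mathfrak{h}}=\mathfrak{h}\oplus\mathbb{C}K\oplus\mathbb{C}L_0$, $\tau^{+}=\mathfrak{n}^{+}\oplus(\mathfrak{g}\otimes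 t\,\mathbb{C}[t])\oplus\bigoplus_{n>0}\mathbb{C}L_n$ and $\tau^{-}=\mathfrak{n}^{-}\oplus(\mathfrak{g}\otimes t^{-1}\mathbb{C}[t^{-1}])\oplus\bigoplus_{n<0}\mathbb{C}L_n$, so that $\tau=\tau^{-}\oplus\bar{\mathfrak{h}}\oplus\tau^{+}$. Let $A$ be a finitely generated commutative associative unital algebra. For a subspace $\mathfrak{s}\subseteq\tau$ and an ideal $I$ of $A$ write $\mathfrak{s}(I)=\mathfrak{s}\otimes I$; then $\tau(A)=\tau\otimes A$ is a Lie algebra with $[x\otimes a,y\otimes b]=[x,y]\otimes ab$. Put $\tau^{0}(A)=\bar{\mathfrak{h}}\otimes A$ and regard $\bar{\mathfrak{h}}$ as $\bar{\mathfrak{h}}\otimes 1$. Let $\psi:\tau^{0}(A)\to\mathbb{C}$ be a linear map, let $M(\psi)=U(\tau(A))\otimes_{U(\tau^{0}(A)\oplus\tau^{+}(A))}\mathbb{C}v$ be the Verma module, where $\tau^{+}(A)v=0$ and $\tau^{0}(A)$ acts on $v$ via $\psi$, and let $V(\psi)$ be its unique irreducible quotient. For $\mu\in\bar{\mathfrak{h}}^{*}$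 let $V(\psi)_{\mu}=\{w\in V(\psi): hw=\mu(h)w\ \text{for all } h\in\bar{\mathfrak{h}}\}$. An ideal $I$ of $A$ is called co-finite if $\dim_{\mathbb{C}}A/I<\infty$. Then $V(\psi)_{\mu}$ is finite-dimensional for every $\mu\in\bar{\mathfrak{h}}^{*}$ if and only if there exists a co-finite ideal $I$ of $A$ with $\psi(\bar{\mathfrak{h}}\otimes I)=0$. Moreover, for every co-finite ideal $I$ of $A$ with $\psi(\bar{\mathfrak{h}}\otimes I)=0$ one has $\tau(I)\,V(\psi)=0$. -/

import Mathlib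

open scoped TensorProduct

noncomputable section

namespace LoopAffineVirasoro

/-- A non-degenerate symmetric invariant bilinear form on a complex Lie algebra. -/
structure InvariantForm (𝔤 : Type*) [LieRing 𝔤] [LieAlgebra ℂ 𝔤] where
  form : LinearMap.BilinForm ℂ 𝔤
  symm : ∀ x y, form x y = form y x
  invariant : ∀ x y z, form ⁅x, y⁆ z = form x ⁅y, z⁆
  nondegenerate : form.Nondegenerate

section Blocks

variable {M N P : Type*} [AddCommGroup M] [Module ℂ M] [AddCommGroup N] [Module ℂ N]
  [AddCommGroup P] [Module ℂ P]

/-- The bilinear map on `(⨁_{n ∈ ℤ} M) × (⨁_{m ∈ ℤ} N)` with the given components. -/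
def bilin (B : ℤ → ℤ → M →ₗ[ℂ] N →ₗ[ℂ] P) : (ℤ →₀ M) →ₗ[ℂ] (ℤ →₀ N) →ₗ[ℂ] P :=
  Finsupp.lsum ℂ fun n => (Finsupp.lsum ℂ fun m => (B n m).flip).flip

@[simp] theorem bilin_single (B : ℤ → ℤ → M →ₗ[ℂ] N →ₗ[ℂ] P) (n m : ℤ) (x : M) (y : N) :
    bilin B (Finsupp.single n x) (Finsupp.single m y) = B n m x y := by
  simp [bilin]

end Blocks

section Tau

variable {𝔤 : Type*} [LieRing 𝔤] [LieAlgebra ℂ 𝔤]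

/-- `[X ⊗ t^n, Y ⊗ t^m] = [X, Y] ⊗ t^(n+m)` on `𝔤 ⊗ ℂ[t, t⁻¹]`; the element `X ⊗ t^n` is
`Finsupp.single n X`. -/
def loopBracket : (ℤ →₀ 𝔤) →ₗ[ℂ] (ℤ →₀ 𝔤) →ₗ[ℂ] (ℤ →₀ 𝔤) :=
  bilin fun n m => (LieModule.toEnd ℂ 𝔤 𝔤 : 𝔤 →ₗ[ℂ] 𝔤 →ₗ[ℂ] 𝔤).compr₂ (Finsupp.lsingle (n + m))

/-- `(X ⊗ t^n, Y ⊗ t^m) ↦ m δ_{m+n,0} (X, Y)`. -/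
def affineCocycle (κ : InvariantForm 𝔤) : (ℤ →₀ 𝔤) →ₗ[ℂ] (ℤ →₀ 𝔤) →ₗ[ℂ] ℂ :=
  bilin fun n m => if m + n = 0 then (m : ℂ) • κ.form else 0

/-- `[L_n, L_m] = (m - n) L_{n+m}`; the element `L_n` is `Finsupp.single n 1`. -/
def wittBracket : (ℤ →₀ ℂ) →ₗ[ℂ] (ℤ →₀ ℂ) →ₗ[ℂ] (ℤ →₀ ℂ) :=
  bilin fun n m => ((m : ℂ) - n) • (LinearMap.mul ℂ ℂ).compr₂ (Finsupp.lsingle (n + m))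

/-- `(L_n, L_m) ↦ δ_{n+m,0} (n³ - n) / 12`. -/
def virasoroCocycle : (ℤ →₀ ℂ) →ₗ[ℂ] (ℤ →₀ ℂ) →ₗ[ℂ] ℂ :=
  bilin fun n m => if n + m = 0 then (((n : ℂ) ^ 3 - n) / 12) • LinearMap.mul ℂ ℂ else 0

/-- `[L_n, X ⊗ t^m] = m X ⊗ t^(m+n)`. -/
def wittAction : (ℤ →₀ ℂ) →ₗ[ℂ] (ℤ →₀ 𝔤) →ₗ[ℂ] (ℤ →₀ 𝔤) :=
  bilin fun n m => (m : ℂ) • (LinearMap.lsmul ℂ 𝔤).compr₂ (Finsupp.lsingle (m + n))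

/-- The underlying space `𝔤 ⊗ ℂ[t, t⁻¹] ⊕ ⨁ ℂ L_n ⊕ ℂ K` of the Affine–Virasoro algebra
`τ = (Vir ⋉ 𝔤̃) / ℂ (K - C₀)`. The third component is the line spanned by the common image of
the centre `K` of the affine algebra and the centre `C₀` of the Virasoro algebra. -/
def Tau (_κ : InvariantForm 𝔤) : Type _ := (ℤ →₀ 𝔤) × (ℤ →₀ ℂ) × ℂ

variable (κ : InvariantForm 𝔤)

instance : AddCommGroup (Tau κ) := inferInstanceAs (AddCommGroup ((ℤ →₀ 𝔤) × (ℤ →₀ ℂ) × ℂ))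

instance : Module ℂ (Tau κ) := inferInstanceAs (Module ℂ ((ℤ →₀ 𝔤) × (ℤ →₀ ℂ) × ℂ))

namespace Tau

/-- The linear map `𝔤 → τ`, `X ↦ X ⊗ t^n`. -/
def X (n : ℤ) : 𝔤 →ₗ[ℂ] Tau κ := LinearMap.inl ℂ (ℤ →₀ 𝔤) ((ℤ →₀ ℂ) × ℂ) ∘ₗ Finsupp.lsingle n

/-- The Virasoro generator `L_n`. -/
def L (n : ℤ) : Tau κ := ((0, Finsupp.single n 1, 0) : (ℤ →₀ 𝔤) × (ℤ →₀ ℂ) × ℂ)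

/-- The canonical central element `K` (equal to `C₀`). -/
def K : Tau κ := ((0, 0, 1) : (ℤ →₀ 𝔤) × (ℤ →₀ ℂ) × ℂ)

/-- The bracket of `τ`. -/
instance : Bracket (Tau κ) (Tau κ) where
  bracket x y :=
    ((loopBracket x.1 y.1 + wittAction x.2.1 y.1 - wittAction y.2.1 x.1,
      wittBracket x.2.1 y.2.1,
      affineCocycle κ x.1 y.1 + virasoroCocycle x.2.1 y.2.1) : (ℤ →₀ 𝔤) × (ℤ →₀ ℂ) × ℂ)

theorem bracket_def (x y : Tau κ) : ⁅x, y⁆ =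
    ((loopBracket x.1 y.1 + wittAction x.2.1 y.1 - wittAction y.2.1 x.1,
      wittBracket x.2.1 y.2.1,
      affineCocycle κ x.1 y.1 + virasoroCocycle x.2.1 y.2.1) : (ℤ →₀ 𝔤) × (ℤ →₀ ℂ) × ℂ) := rfl

theorem add_bracket (x y z : Tau κ) : ⁅x + y, z⁆ = ⁅x, z⁆ + ⁅y, z⁆ := by
  rw [bracket_def, bracket_def, bracket_def]
  have h1 : (x + y).1 = x.1 + y.1 := rfl
  have h2 : (x + y).2.1 = x.2.1 + y.2.1 := rfl
  rw [h1, h2]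
  refine Prod.ext ?_ (Prod.ext ?_ ?_)
  · change _ = (_ : ℤ →₀ 𝔤) + _
    simp only [map_add, LinearMap.add_apply]
    abel
  · change _ = (_ : ℤ →₀ ℂ) + _
    simp only [map_add, LinearMap.add_apply]
  · change _ = (_ : ℂ) + _
    simp only [map_add, LinearMap.add_apply]
    ring

theorem bracket_add (x y z : Tau κ) : ⁅x, y + z⁆ = ⁅x, y⁆ + ⁅x, z⁆ := by
  rw [bracket_def, bracket_def, bracket_def]
  have h1 : (y + z).1 = y.1 + z.1 := rfl
  have h2 : (y + z).2.1 = y.2.1 + z.2.1 := rfl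
  rw [h1, h2]
  refine Prod.ext ?_ (Prod.ext ?_ ?_)
  · change _ = (_ : ℤ →₀ 𝔤) + _
    simp only [map_add, LinearMap.add_apply]
    abel
  · change _ = (_ : ℤ →₀ ℂ) + _
    simp only [map_add]
  · change _ = (_ : ℂ) + _
    simp only [map_add]
    ring

theorem bracket_smul (c : ℂ) (x y : Tau κ) : ⁅x, c • y⁆ = c • ⁅x, y⁆ := by
  rw [bracket_def, bracket_def]
  have h1 : (c • y).1 = c • y.1 := rfl
  have h2 : (c • y).2.1 = c • y.2.1 := rfl
  rw [h1, h2]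
  refine Prod.ext ?_ (Prod.ext ?_ ?_)
  · change _ = c • (_ : ℤ →₀ 𝔤)
    simp only [map_smul, LinearMap.smul_apply, smul_add, smul_sub]
  · change _ = c • (_ : ℤ →₀ ℂ)
    simp only [map_smul]
  · change _ = c • (_ : ℂ)
    simp only [map_smul, smul_add]

theorem smul_bracket (c : ℂ) (x y : Tau κ) : ⁅c • x, y⁆ = c • ⁅x, y⁆ := by
  rw [bracket_def, bracket_def]
  have h1 : (c • x).1 = c • x.1 := rfl
  have h2 : (c • x).2.1 = c • x.2.1 := rfl
  rw [h1, h2]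
  refine Prod.ext ?_ (Prod.ext ?_ ?_)
  · change _ = c • (_ : ℤ →₀ 𝔤)
    simp only [map_smul, LinearMap.smul_apply, smul_add, smul_sub]
  · change _ = c • (_ : ℤ →₀ ℂ)
    simp only [map_smul, LinearMap.smul_apply]
  · change _ = c • (_ : ℂ)
    simp only [map_smul, LinearMap.smul_apply, smul_add]

theorem X_bracket_X (n m : ℤ) (x y : 𝔤) : ⁅X κ n x, X κ m y⁆ =
    X κ (m + n) ⁅x, y⁆ + (if m + n = 0 then (m : ℂ) * κ.form x y else 0) • K κ := by
  rw [bracket_def, add_comm m n]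
  refine Prod.ext ?_ (Prod.ext ?_ ?_)
  · change loopBracket (Finsupp.single n x) (Finsupp.single m y) +
        wittAction (0 : ℤ →₀ ℂ) (Finsupp.single m y) -
        wittAction (0 : ℤ →₀ ℂ) (Finsupp.single n x) =
      Finsupp.single (n + m) ⁅x, y⁆ + (_ : ℂ) • (0 : ℤ →₀ 𝔤)
    simp [loopBracket]
  · change wittBracket (0 : ℤ →₀ ℂ) (0 : ℤ →₀ ℂ) = 0 + (_ : ℂ) • (0 : ℤ →₀ ℂ)
    simp
  · change affineCocycle κ (Finsupp.single n x) (Finsupp.single m y) +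
        virasoroCocycle (0 : ℤ →₀ ℂ) (0 : ℤ →₀ ℂ) = 0 + (_ : ℂ) • (1 : ℂ)
    by_cases h : n + m = 0 <;> simp [affineCocycle, add_comm m n, h]

theorem L_bracket_X (n m : ℤ) (x : 𝔤) : ⁅L κ n, X κ m x⁆ = (m : ℂ) • X κ (m + n) x := by
  rw [bracket_def]
  refine Prod.ext ?_ (Prod.ext ?_ ?_)
  · change loopBracket (0 : ℤ →₀ 𝔤) (Finsupp.single m x) +
        wittAction (Finsupp.single n 1) (Finsupp.single m x) -
        wittAction (0 : ℤ →₀ ℂ) (0 : ℤ →₀ 𝔤) = (m : ℂ) • Finsupp.single (m + n) x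
    simp [wittAction]
  · change wittBracket (Finsupp.single n 1) (0 : ℤ →₀ ℂ) = (m : ℂ) • (0 : ℤ →₀ ℂ)
    simp
  · change affineCocycle κ (0 : ℤ →₀ 𝔤) (Finsupp.single m x) +
        virasoroCocycle (Finsupp.single n 1) (0 : ℤ →₀ ℂ) = (m : ℂ) • (0 : ℂ)
    simp

theorem X_bracket_L (n m : ℤ) (x : 𝔤) : ⁅X κ m x, L κ n⁆ = -((m : ℂ) • X κ (m + n) x) := by
  rw [bracket_def]
  refine Prod.ext ?_ (Prod.ext ?_ ?_)
  · change loopBracket (Finsupp.single m x) (0 : ℤ →₀ 𝔤) +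
        wittAction (0 : ℤ →₀ ℂ) (0 : ℤ →₀ 𝔤) -
        wittAction (Finsupp.single n 1) (Finsupp.single m x) =
      -((m : ℂ) • Finsupp.single (m + n) x)
    simp [wittAction]
  · change wittBracket (0 : ℤ →₀ ℂ) (Finsupp.single n 1) = -((m : ℂ) • (0 : ℤ →₀ ℂ))
    simp
  · change affineCocycle κ (Finsupp.single m x) (0 : ℤ →₀ 𝔤) +
        virasoroCocycle (0 : ℤ →₀ ℂ) (Finsupp.single n 1) = -((m : ℂ) • (0 : ℂ))
    simp

theorem L_bracket_L (n m : ℤ) : ⁅L κ n, L κ m⁆ =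
    ((m : ℂ) - n) • L κ (n + m) + (if n + m = 0 then ((n : ℂ) ^ 3 - n) / 12 else 0) • K κ := by
  rw [bracket_def]
  refine Prod.ext ?_ (Prod.ext ?_ ?_)
  · change loopBracket (0 : ℤ →₀ 𝔤) (0 : ℤ →₀ 𝔤) +
        wittAction (Finsupp.single n 1) (0 : ℤ →₀ 𝔤) -
        wittAction (Finsupp.single m 1) (0 : ℤ →₀ 𝔤) =
      ((m : ℂ) - n) • (0 : ℤ →₀ 𝔤) + (_ : ℂ) • (0 : ℤ →₀ 𝔤)
    simp
  · change wittBracket (Finsupp.single n 1) (Finsupp.single m 1) =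
      ((m : ℂ) - n) • Finsupp.single (n + m) (1 : ℂ) + (_ : ℂ) • (0 : ℤ →₀ ℂ)
    simp [wittBracket]
  · change affineCocycle κ (0 : ℤ →₀ 𝔤) (0 : ℤ →₀ 𝔤) +
        virasoroCocycle (Finsupp.single n 1) (Finsupp.single m 1) =
      ((m : ℂ) - n) • (0 : ℂ) + (_ : ℂ) • (1 : ℂ)
    by_cases h : n + m = 0 <;> simp [virasoroCocycle, h]

theorem K_bracket (x : Tau κ) : ⁅K κ, x⁆ = 0 := by
  rw [bracket_def]
  refine Prod.ext ?_ (Prod.ext ?_ ?_)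
  · change loopBracket (0 : ℤ →₀ 𝔤) x.1 + wittAction (0 : ℤ →₀ ℂ) x.1 -
        wittAction x.2.1 (0 : ℤ →₀ 𝔤) = 0
    simp
  · change wittBracket (0 : ℤ →₀ ℂ) x.2.1 = 0
    simp
  · change affineCocycle κ (0 : ℤ →₀ 𝔤) x.1 + virasoroCocycle (0 : ℤ →₀ ℂ) x.2.1 = 0
    simp

theorem bracket_K (x : Tau κ) : ⁅x, K κ⁆ = 0 := by
  rw [bracket_def]
  refine Prod.ext ?_ (Prod.ext ?_ ?_)
  · change loopBracket x.1 (0 : ℤ →₀ 𝔤) + wittAction x.2.1 (0 : ℤ →₀ 𝔤) -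
        wittAction (0 : ℤ →₀ ℂ) x.1 = 0
    simp
  · change wittBracket x.2.1 (0 : ℤ →₀ ℂ) = 0
    simp
  · change affineCocycle κ x.1 (0 : ℤ →₀ 𝔤) + virasoroCocycle x.2.1 (0 : ℤ →₀ ℂ) = 0
    simp

theorem induction {p : Tau κ → Prop} (hX : ∀ n x, p (X κ n x)) (hL : ∀ n, p (L κ n))
    (hK : p (K κ)) (hadd : ∀ x y, p x → p y → p (x + y)) (hsmul : ∀ (c : ℂ) x, p x → p (c • x))
    (x : Tau κ) : p x := by
  have h0 : p 0 := by simpa using hsmul 0 _ hK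
  have h1 : ∀ f : ℤ →₀ 𝔤, p (((f, 0, 0) : (ℤ →₀ 𝔤) × (ℤ →₀ ℂ) × ℂ)) := by
    intro f
    induction f using Finsupp.induction_linear with
    | zero => exact h0
    | add f g hf hg =>
      refine (congrArg p ?_).mp (hadd _ _ hf hg)
      exact Prod.ext rfl (Prod.ext (add_zero (0 : ℤ →₀ ℂ)) (add_zero (0 : ℂ)))
    | single n x => exact hX n x
  have h2 : ∀ f : ℤ →₀ ℂ, p (((0, f, 0) : (ℤ →₀ 𝔤) × (ℤ →₀ ℂ) × ℂ)) := by
    intro f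
    induction f using Finsupp.induction_linear with
    | zero => exact h0
    | add f g hf hg =>
      refine (congrArg p ?_).mp (hadd _ _ hf hg)
      exact Prod.ext (add_zero (0 : ℤ →₀ 𝔤)) (Prod.ext rfl (add_zero (0 : ℂ)))
    | single n c =>
      refine (congrArg p ?_).mp (hsmul c _ (hL n))
      refine Prod.ext (smul_zero c) (Prod.ext ?_ (smul_zero c))
      change c • Finsupp.single n (1 : ℂ) = Finsupp.single n c
      simp
  have h3 : ∀ c : ℂ, p (((0, 0, c) : (ℤ →₀ 𝔤) × (ℤ →₀ ℂ) × ℂ)) := by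
    intro c
    refine (congrArg p ?_).mp (hsmul c _ hK)
    exact Prod.ext (smul_zero c) (Prod.ext (smul_zero c) (mul_one c))
  obtain ⟨f, g, c⟩ := x
  refine (congrArg p ?_).mp (hadd _ _ (hadd _ _ (h1 f) (h2 g)) (h3 c))
  refine Prod.ext ?_ (Prod.ext ?_ ?_)
  · change f + 0 + 0 = f
    simp
  · change 0 + g + 0 = g
    simp
  · change (0 : ℂ) + 0 + c = c
    simp

theorem bracket_skew (x y : Tau κ) : ⁅x, y⁆ = -⁅y, x⁆ := by
  induction x using Tau.induction with
  | hadd x x' hx hx' => rw [add_bracket, bracket_add, hx, hx', neg_add]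
  | hsmul c x hx => rw [smul_bracket, bracket_smul, hx, smul_neg]
  | hK => rw [K_bracket, bracket_K, neg_zero]
  | hX n x =>
    induction y using Tau.induction with
    | hadd y y' hy hy' => rw [add_bracket, bracket_add, hy, hy', neg_add]
    | hsmul c y hy => rw [smul_bracket, bracket_smul, hy, smul_neg]
    | hK => rw [K_bracket, bracket_K, neg_zero]
    | hX m y =>
      rw [X_bracket_X, X_bracket_X, neg_add, ← neg_smul, ← lie_skew, map_neg, add_comm n m,
        κ.symm y x]
      by_cases h : m + n = 0
      · obtain rfl : m = -n := by omega
        simp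
      · simp [h]
    | hL m => rw [X_bracket_L, L_bracket_X]
  | hL n =>
    induction y using Tau.induction with
    | hadd y y' hy hy' => rw [add_bracket, bracket_add, hy, hy', neg_add]
    | hsmul c y hy => rw [smul_bracket, bracket_smul, hy, smul_neg]
    | hK => rw [K_bracket, bracket_K, neg_zero]
    | hX m y => rw [X_bracket_L, L_bracket_X, neg_neg]
    | hL m =>
      rw [L_bracket_L, L_bracket_L, neg_add, ← neg_smul, ← neg_smul, add_comm m n]
      by_cases h : n + m = 0
      · obtain rfl : m = -n := by omega
        simp
        module
      · simp [h]

theorem bracket_zero (x : Tau κ) : ⁅x, (0 : Tau κ)⁆ = 0 := by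
  simpa using bracket_smul κ 0 x 0

theorem zero_bracket (x : Tau κ) : ⁅(0 : Tau κ), x⁆ = 0 := by
  simpa using smul_bracket κ 0 0 x

theorem bracket_neg (x y : Tau κ) : ⁅x, -y⁆ = -⁅x, y⁆ := by
  simpa using bracket_smul κ (-1) x y

theorem neg_bracket (x y : Tau κ) : ⁅-x, y⁆ = -⁅x, y⁆ := by
  simpa using smul_bracket κ (-1) x y

set_option linter.unusedSimpArgs false in
theorem bracket_leibniz (x y z : Tau κ) : ⁅x, ⁅y, z⁆⁆ = ⁅⁅x, y⁆, z⁆ + ⁅y, ⁅x, z⁆⁆ := by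
  induction x using Tau.induction with
  | hadd x x' hx hx' => simp only [add_bracket, bracket_add, hx, hx']; abel
  | hsmul c x hx => simp only [smul_bracket, bracket_smul, hx, smul_add]
  | hK => simp only [K_bracket, zero_bracket, bracket_zero, add_zero]
  | hX n x =>
    induction y using Tau.induction with
    | hadd y y' hy hy' => simp only [add_bracket, bracket_add, hy, hy']; abel
    | hsmul c y hy => simp only [smul_bracket, bracket_smul, hy, smul_add]
    | hK => simp only [K_bracket, bracket_K, zero_bracket, bracket_zero, add_zero]
    | hX m y =>
      induction z using Tau.induction with
      | hadd z z' hz hz' => simp only [bracket_add, hz, hz']; abel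
      | hsmul c z hz => simp only [bracket_smul, hz, smul_add]
      | hK => simp only [bracket_K, bracket_zero, add_zero]
      | hX k z =>
        simp only [X_bracket_X, X_bracket_L, L_bracket_X, L_bracket_L, add_bracket, bracket_add,
          smul_bracket, bracket_smul, neg_bracket, bracket_neg, K_bracket, bracket_K, smul_zero, add_zero]
        rw [show k + m + n = n + m + k by ring, show k + (m + n) = n + m + k by ring,
          show k + n + m = n + m + k by ring, leibniz_lie x y z, map_add]
        by_cases h : n + m + k = 0
        · have h1 : κ.form ⁅x, y⁆ z = κ.form x ⁅y, z⁆ := κ.invariant x y z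
          have h2 : κ.form y ⁅x, z⁆ = -κ.form x ⁅y, z⁆ := by
            rw [← κ.invariant, ← lie_skew, map_neg, LinearMap.neg_apply, h1]
          have h3 : (k : ℂ) = -n - m := by
            have : k = -n - m := by omega
            rw [this]; push_cast; ring
          simp only [h, if_true, h1, h2, h3]
          push_cast
          rw [h3]
          module
        · simp only [h, if_false]
          module
      | hL k =>
        simp only [X_bracket_X, X_bracket_L, L_bracket_X, L_bracket_L, add_bracket, bracket_add,
          smul_bracket, bracket_smul, neg_bracket, bracket_neg, K_bracket, bracket_K, smul_zero, add_zero]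
        rw [show m + n + k = n + m + k by ring, show n + k + m = n + m + k by ring]
        rw [show m + k + n = n + m + k by ring, ← lie_skew x y, map_neg, κ.symm y x]
        by_cases h : n + m + k = 0
        · have h3 : (k : ℂ) = -n - m := by
            have : k = -n - m := by omega
            rw [this]; push_cast; ring
          simp only [h, if_true]
          push_cast
          rw [h3]
          module
        · simp only [h, if_false]
          push_cast
          module
    | hL m =>
      induction z using Tau.induction with
      | hadd z z' hz hz' => simp only [bracket_add, hz, hz']; abel
      | hsmul c z hz => simp only [bracket_smul, hz, smul_add]
      | hK => simp only [bracket_K, bracket_zero, add_zero]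
      | hX k z =>
        simp only [X_bracket_X, X_bracket_L, L_bracket_X, L_bracket_L, add_bracket, bracket_add,
          smul_bracket, bracket_smul, neg_bracket, bracket_neg, K_bracket, bracket_K, smul_zero, add_zero]
        rw [show k + m + n = n + m + k by ring, show k + (n + m) = n + m + k by ring, show k + n + m = n + m + k by ring]
        by_cases h : n + m + k = 0
        · have h3 : (k : ℂ) = -n - m := by
            have : k = -n - m := by omega
            rw [this]; push_cast; ring
          simp only [h, if_true]
          push_cast
          rw [h3]
          module
        · simp only [h, if_false]
          push_cast
          module
      | hL k =>
        simp only [X_bracket_X, X_bracket_L, L_bracket_X, L_bracket_L, add_bracket, bracket_add,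
          smul_bracket, bracket_smul, neg_bracket, bracket_neg, K_bracket, bracket_K, smul_zero, add_zero]
        rw [show n + (m + k) = n + m + k by ring, show n + k + m = n + m + k by ring]
        push_cast
        module
  | hL n =>
    induction y using Tau.induction with
    | hadd y y' hy hy' => simp only [add_bracket, bracket_add, hy, hy']; abel
    | hsmul c y hy => simp only [smul_bracket, bracket_smul, hy, smul_add]
    | hK => simp only [K_bracket, bracket_K, zero_bracket, bracket_zero, add_zero]
    | hX m y =>
      induction z using Tau.induction with
      | hadd z z' hz hz' => simp only [bracket_add, hz, hz']; abel
      | hsmul c z hz => simp only [bracket_smul, hz, smul_add]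
      | hK => simp only [bracket_K, bracket_zero, add_zero]
      | hX k z =>
        simp only [X_bracket_X, X_bracket_L, L_bracket_X, L_bracket_L, add_bracket, bracket_add,
          smul_bracket, bracket_smul, neg_bracket, bracket_neg, K_bracket, bracket_K, smul_zero, add_zero]
        rw [show k + m + n = n + m + k by ring, show k + (m + n) = n + m + k by ring, show k + n + m = n + m + k by ring]
        by_cases h : n + m + k = 0
        · have h3 : (k : ℂ) = -n - m := by
            have : k = -n - m := by omega
            rw [this]; push_cast; ring
          simp only [h, if_true]
          push_cast
          rw [h3]
          module
        · simp only [h, if_false]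
          push_cast
          module
      | hL k =>
        simp only [X_bracket_X, X_bracket_L, L_bracket_X, L_bracket_L, add_bracket, bracket_add,
          smul_bracket, bracket_smul, neg_bracket, bracket_neg, K_bracket, bracket_K, smul_zero, add_zero]
        rw [show m + k + n = n + m + k by ring, show m + n + k = n + m + k by ring, show m + (n + k) = n + m + k by ring]
        push_cast
        module
    | hL m =>
      induction z using Tau.induction with
      | hadd z z' hz hz' => simp only [bracket_add, hz, hz']; abel
      | hsmul c z hz => simp only [bracket_smul, hz, smul_add]
      | hK => simp only [bracket_K, bracket_zero, add_zero]
      | hX k z =>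
        simp only [X_bracket_X, X_bracket_L, L_bracket_X, L_bracket_L, add_bracket, bracket_add,
          smul_bracket, bracket_smul, neg_bracket, bracket_neg, K_bracket, bracket_K, smul_zero, add_zero]
        rw [show k + m + n = n + m + k by ring, show k + (n + m) = n + m + k by ring, show k + n + m = n + m + k by ring]
        push_cast
        module
      | hL k =>
        simp only [X_bracket_X, X_bracket_L, L_bracket_X, L_bracket_L, add_bracket, bracket_add,
          smul_bracket, bracket_smul, neg_bracket, bracket_neg, K_bracket, bracket_K, smul_zero, add_zero]
        rw [show n + (m + k) = n + m + k by ring, show m + (n + k) = n + m + k by ring]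
        by_cases h : n + m + k = 0
        · have h3 : (k : ℂ) = -n - m := by
            have : k = -n - m := by omega
            rw [this]; push_cast; ring
          simp only [h, if_true]
          push_cast
          rw [h3]
          module
        · simp only [h, if_false]
          push_cast
          module

instance : LieRing (Tau κ) where
  add_lie := add_bracket κ
  lie_add := bracket_add κ
  lie_self x := by
    have h := bracket_skew κ x x
    have h2 : (2 : ℂ) • ⁅x, x⁆ = 0 := by
      rw [two_smul]
      exact eq_neg_iff_add_eq_zero.mp h
    exact (smul_eq_zero.mp h2).resolve_left two_ne_zero
  leibniz_lie := bracket_leibniz κ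

instance : LieAlgebra ℂ (Tau κ) where
  lie_smul := bracket_smul κ

end Tau

end Tau

/-! ### Triangular decomposition, Verma modules and their irreducible quotients -/

section Triangular

variable {𝔤 : Type*} [LieRing 𝔤] [LieAlgebra ℂ 𝔤] (κ : InvariantForm 𝔤) (H : LieSubalgebra ℂ 𝔤)

/-- `𝔥̄ = 𝔥 ⊕ ℂ K ⊕ ℂ L₀`, so that `τ⁰(A)` is `A ⊗ 𝔥̄`. -/
def hbar : Submodule ℂ (Tau κ) :=
  H.toSubmodule.map (Tau.X κ 0) ⊔ Submodule.span ℂ {Tau.K κ, Tau.L κ 0}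

variable [FiniteDimensional ℂ 𝔤] [LieAlgebra.IsSimple ℂ 𝔤] [H.IsCartanSubalgebra]
variable (b : (LieAlgebra.IsKilling.rootSystem H).Base)

/-- The sum of the root spaces of `𝔤` for the roots that are positive with respect to `b`. -/
def nPos : Submodule ℂ 𝔤 :=
  ⨆ α : H.root, ⨆ _ : b.IsPos α, (LieAlgebra.rootSpace H α.1).toSubmodule

/-- `τ⁺ = N⁺ ⊕ L⁺`, where `N⁺ = 𝔫⁺ ⊕ 𝔤 ⊗ t ℂ[t]` and `L⁺ = ⨁_{n > 0} ℂ L_n`. -/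
def tauPos : Submodule ℂ (Tau κ) :=
  (nPos H b).map (Tau.X κ 0) ⊔ (⨆ n : ℤ, ⨆ _ : 0 < n, LinearMap.range (Tau.X κ n)) ⊔
    Submodule.span ℂ {y | ∃ n : ℤ, 0 < n ∧ y = Tau.L κ n}

variable (A : Type*) [CommRing A] [Algebra ℂ A]

/-- The universal enveloping algebra of the loop algebra `τ(A) = τ ⊗ A`. -/
abbrev Env : Type _ := UniversalEnvelopingAlgebra ℂ (A ⊗[ℂ] Tau κ)

variable {A}

/-- The element `x(a) = x ⊗ a` of `τ(A)` inside the enveloping algebra. -/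
def elt (a : A) (x : Tau κ) : Env κ A := UniversalEnvelopingAlgebra.ι ℂ (a ⊗ₜ[ℂ] x)

variable {κ H}

/-- The left ideal of `U(τ(A))` generated by `τ⁺(A)` and by all `z - ψ(z)`, `z ∈ τ⁰(A)`. -/
def vermaIdeal (ψ : A ⊗[ℂ] hbar κ H →ₗ[ℂ] ℂ) : Submodule (Env κ A) (Env κ A) :=
  Submodule.span (Env κ A)
    ({u | ∃ a : A, ∃ x ∈ tauPos κ H b, u = elt κ a x} ∪
      {u | ∃ (a : A) (h : hbar κ H), u = elt κ a (h : Tau κ) - algebraMap ℂ (Env κ A) (ψ (a ⊗ₜ h))})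

/-- The Verma module `M(ψ)`, the module induced from the one-dimensional module `ℂ v` of
`τ⁰(A) ⊕ τ⁺(A)` given by `ψ`, as a left module over `U(τ(A))`. -/
abbrev Verma (ψ : A ⊗[ℂ] hbar κ H →ₗ[ℂ] ℂ) : Type _ := Env κ A ⧸ vermaIdeal b ψ

/-- The sum of all proper submodules of `M(ψ)`, that is, its unique maximal proper submodule. -/
def vermaMax (ψ : A ⊗[ℂ] hbar κ H →ₗ[ℂ] ℂ) : Submodule (Env κ A) (Verma b ψ) :=
  sSup {N | N ≠ ⊤}

/-- The unique irreducible quotient `V(ψ)` of `M(ψ)`. -/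
abbrev IrrHW (ψ : A ⊗[ℂ] hbar κ H →ₗ[ℂ] ℂ) : Type _ := Verma b ψ ⧸ vermaMax b ψ

/-- The weight space `V_μ = {v | h v = μ(h) v for all h ∈ 𝔥̄}` of `V(ψ)`, where `𝔥̄` sits in
`τ(A)` as `𝔥̄ ⊗ 1`. -/
def weightSpace (ψ : A ⊗[ℂ] hbar κ H →ₗ[ℂ] ℂ) (μ : hbar κ H →ₗ[ℂ] ℂ) :
    Submodule ℂ (IrrHW b ψ) where
  carrier := {v | ∀ h : hbar κ H, elt κ (1 : A) (h : Tau κ) • v = μ h • v}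
  add_mem' hv hw h := by rw [smul_add, smul_add, hv h, hw h]
  zero_mem' h := by rw [smul_zero, smul_zero]
  smul_mem' c v hv h := by rw [smul_comm, hv h, smul_comm]

end Triangular

end LoopAffineVirasoro

end

/-! Everything rests on an integral grading. Choose `ρ ∈ 𝔥` on which each root takes its height as
value, and `N` exceeding all heights in absolute value. The adjoint eigenvalues of `d = N L₀ + ρ` on
`τ(A)` are integers; the degree-zero part is `𝔥̄(A)` and the sum of the positive parts is `τ⁺(A)`.
So `V(ψ)` is a highest weight module on which the eigenvalues of `d` descend in integer steps from
that of the generator `v`.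

If `ψ` kills `𝔥̄(I)`, then `τ(I)` is a graded ideal, and by induction on `m` its elements of degree
`-m` send `v` to singular vectors. Below the top a nonzero singular vector generates a proper
submodule, so irreducibility makes these vectors zero. The vectors killed by `τ(I)` form a submodule
containing `v`, hence are everything (`lieAct_eq_zero_of_mem_ideal`). For co-finite `I` each graded
piece of `τ(A)` then acts through a finite-dimensional space, so the eigenspaces of `d`, and with
them the weight spaces, are finite-dimensional.

Conversely, take a weight vector `y` of `τ⁻` and `x ∈ τ⁺` with `[x, y] = z ∈ 𝔥̄`. The `a` with
`y(a)v = 0` form an ideal, co-finite because `y(A)v` lies in one weight space; applying `x` gives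
`ψ(z ⊗ a)v = 0` (`exists_cofinite_ideal_of_weight_vector`). Suitable pairs produce `L₀`, `K` and the
simple coroots, which span `𝔥̄`, and finitely many co-finite ideals are intersected.

This last direction needs `v ≠ 0` in `V(ψ)`. Instead of a PBW basis, the induced module is realised
on the enveloping algebra of the negative part (`exists_inducedFunctional`); it yields a functional
with value `1` at `v` that vanishes on all proper submodules of `M(ψ)`. -/

open scoped TensorProduct

noncomputable section

namespace LoopAffineVirasoro

/-! ### Induced modules realised on `U(𝔫)`, without a PBW basis -/

section InducedFunctional

variable {R : Type*} [CommRing R] {L : Type*} [LieRing L] [LieAlgebra R L]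

attribute [local instance 100] LieRing.ofAssociativeRing

theorem ι_lie (x y : L) : UniversalEnvelopingAlgebra.ι R ⁅x, y⁆ =
    UniversalEnvelopingAlgebra.ι R x * UniversalEnvelopingAlgebra.ι R y -
      UniversalEnvelopingAlgebra.ι R y * UniversalEnvelopingAlgebra.ι R x := by
  rw [LieHom.map_lie, LieRing.of_associative_ring_bracket]

/-- A property of elements of the enveloping algebra that holds on scalars and is stable under
sums and products holds everywhere as soon as it holds on the generators. -/
theorem envelopingAlgebra_induction {p : UniversalEnvelopingAlgebra R L → Prop}
    (halg : ∀ r, p (algebraMap R _ r)) (hι : ∀ x, p (UniversalEnvelopingAlgebra.ι R x))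
    (hadd : ∀ u w, p u → p w → p (u + w)) (hmul : ∀ u w, p u → p w → p (u * w))
    (u : UniversalEnvelopingAlgebra R L) : p u := by
  let S : Subalgebra R (UniversalEnvelopingAlgebra R L) :=
    { carrier := {u | p u}
      mul_mem' := fun {a b} => hmul a b
      add_mem' := fun {a b} => hadd a b
      algebraMap_mem' := halg }
  let f : L →ₗ⁅R⁆ S :=
    { toFun := fun x => ⟨UniversalEnvelopingAlgebra.ι R x, hι x⟩
      map_add' := fun x y => Subtype.ext (map_add _ x y)
      map_smul' := fun c x => Subtype.ext (map_smul _ c x)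
      map_lie' := fun {x y} => Subtype.ext (ι_lie x y) }
  -- Lifting the generators into `S` and including back fixes the generators, so it is the identity,
  -- and every element lies in `S`.
  have h : S.val.comp (UniversalEnvelopingAlgebra.lift R f) = AlgHom.id R _ := by
    refine UniversalEnvelopingAlgebra.hom_ext R (LieHom.ext fun x => ?_)
    change ((UniversalEnvelopingAlgebra.lift R f (UniversalEnvelopingAlgebra.ι R x) : S) :
      UniversalEnvelopingAlgebra R L) = UniversalEnvelopingAlgebra.ι R x
    rw [UniversalEnvelopingAlgebra.lift_ι_apply]
    rfl
  have h2 := DFunLike.congr_fun h u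
  have h3 : (UniversalEnvelopingAlgebra.lift R f u : UniversalEnvelopingAlgebra R L) = u := h2
  rw [← h3]
  exact (UniversalEnvelopingAlgebra.lift R f u).2

/-- A submodule containing `1` and stable under left multiplication by the generators is
everything. -/
theorem eq_top_of_one_mem_of_ι_mul_mem (S : Submodule R (UniversalEnvelopingAlgebra R L))
    (h1 : (1 : UniversalEnvelopingAlgebra R L) ∈ S)
    (h : ∀ x, ∀ u ∈ S, UniversalEnvelopingAlgebra.ι R x * u ∈ S) : S = ⊤ := by
  have key : ∀ w : UniversalEnvelopingAlgebra R L, ∀ u ∈ S, w * u ∈ S := by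
    intro w
    induction w using envelopingAlgebra_induction with
    | halg r => intro u hu; rw [← Algebra.smul_def]; exact S.smul_mem r hu
    | hι x => exact h x
    | hadd a b ha hb => intro u hu; rw [add_mul]; exact S.add_mem (ha u hu) (hb u hu)
    | hmul a b ha hb => intro u hu; rw [mul_assoc]; exact ha _ (hb u hu)
  exact eq_top_iff.mpr fun w _ => by simpa using key w 1 h1

variable (n : LieSubalgebra R L) (pn : L →ₗ[R] n) (pb : L →ₗ[R] L)

local notation "U" => UniversalEnvelopingAlgebra R n

/-- The action of `y ∈ 𝔫` on pairs `(u, f)` that governs how `𝔟` acts on the module induced from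
`𝔟`, for a decomposition `L = 𝔫 ⊕ 𝔟` with projections `pn` and `pb`. -/
def inducedStep (y : n) : (U × (L →ₗ[R] U)) →ₗ[R] (U × (L →ₗ[R] U)) where
  toFun p := (UniversalEnvelopingAlgebra.ι R y * p.1,
    { toFun := fun x => UniversalEnvelopingAlgebra.ι R y * p.2 x +
        UniversalEnvelopingAlgebra.ι R (pn ⁅x, (y : L)⁆) * p.1 + p.2 (pb ⁅x, (y : L)⁆)
      map_add' := fun x x' => by simp only [add_lie, map_add, mul_add, add_mul]; abel
      map_smul' := fun c x => by
        simp only [smul_lie, map_smul, mul_smul_comm, smul_mul_assoc, smul_add, RingHom.id_apply] })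
  map_add' p q := by
    refine Prod.ext (mul_add _ _ _) (LinearMap.ext fun x => ?_)
    simp only [Prod.fst_add, Prod.snd_add, LinearMap.coe_mk, AddHom.coe_mk, LinearMap.add_apply,
      mul_add]
    abel
  map_smul' c p := by
    refine Prod.ext (mul_smul_comm _ _ _) (LinearMap.ext fun x => ?_)
    simp only [Prod.smul_fst, Prod.smul_snd, LinearMap.coe_mk, AddHom.coe_mk, LinearMap.smul_apply,
      mul_smul_comm, smul_add, RingHom.id_apply]

variable {n pn pb}

/-- After expansion the terms are matched by the Jacobi identity and by `pb = id - pn`. This makes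
the steps a representation of `𝔫`, which therefore extends to `U(𝔫)` with no choice of basis. -/
theorem inducedStep_lie (hdec : ∀ x, (pn x : L) + pb x = x) (hn : ∀ y : n, pn y = y)
    (y z : n) : inducedStep n pn pb ⁅y, z⁆ =
      inducedStep n pn pb y * inducedStep n pn pb z -
        inducedStep n pn pb z * inducedStep n pn pb y := by
  have hb : ∀ y : n, pb y = 0 := fun y => by
    have := hdec y
    rwa [hn, add_eq_left] at this
  have split : ∀ x : L, ∀ w : n, ⁅pb x, (w : L)⁆ = ⁅x, (w : L)⁆ - (⁅pn x, w⁆ : n) := fun x w => by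
    rw [LieSubalgebra.coe_bracket, ← sub_lie, eq_sub_of_add_eq' (hdec x)]
  have jac : ∀ x : L, ⁅⁅x, (y : L)⁆, (z : L)⁆ - ⁅⁅x, (z : L)⁆, (y : L)⁆ = ⁅x, ⁅(y : L), (z : L)⁆⁆ :=
    fun x => by
      rw [leibniz_lie x, ← lie_skew ⁅x, (z : L)⁆ (y : L)]; abel
  refine LinearMap.ext fun p => Prod.ext ?_ (LinearMap.ext fun x => ?_)
  · change UniversalEnvelopingAlgebra.ι R ⁅y, z⁆ * p.1 =
      UniversalEnvelopingAlgebra.ι R y * (UniversalEnvelopingAlgebra.ι R z * p.1) -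
        UniversalEnvelopingAlgebra.ι R z * (UniversalEnvelopingAlgebra.ι R y * p.1)
    rw [ι_lie, sub_mul, mul_assoc, mul_assoc]
  · obtain ⟨u, f⟩ := p
    set i := UniversalEnvelopingAlgebra.ι R (L := n) with hi
    change i ⁅y, z⁆ * f x + i (pn ⁅x, ((⁅y, z⁆ : n) : L)⁆) * u + f (pb ⁅x, ((⁅y, z⁆ : n) : L)⁆) =
      (i y * (i z * f x + i (pn ⁅x, (z : L)⁆) * u + f (pb ⁅x, (z : L)⁆)) +
        i (pn ⁅x, (y : L)⁆) * (i z * u) +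
        (i z * f (pb ⁅x, (y : L)⁆) + i (pn ⁅pb ⁅x, (y : L)⁆, (z : L)⁆) * u +
          f (pb ⁅pb ⁅x, (y : L)⁆, (z : L)⁆))) -
      (i z * (i y * f x + i (pn ⁅x, (y : L)⁆) * u + f (pb ⁅x, (y : L)⁆)) +
        i (pn ⁅x, (z : L)⁆) * (i y * u) +
        (i y * f (pb ⁅x, (z : L)⁆) + i (pn ⁅pb ⁅x, (z : L)⁆, (y : L)⁆) * u +
          f (pb ⁅pb ⁅x, (z : L)⁆, (y : L)⁆)))
    rw [LieSubalgebra.coe_bracket, ← jac, split ⁅x, (y : L)⁆ z, split ⁅x, (z : L)⁆ y]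
    simp only [map_sub, hn, hb, hi, ι_lie]
    noncomm_ring

/-- The pair `(u, Φ u)`, where `Φ u x = x • u` for `x ∈ 𝔟` in the induced module. -/
def inducedPair (hdec : ∀ x, (pn x : L) + pb x = x) (hn : ∀ y : n, pn y = y) :
    U →ₐ[R] Module.End R (U × (L →ₗ[R] U)) :=
  UniversalEnvelopingAlgebra.lift R
    { toFun := inducedStep n pn pb
      map_add' := fun y z => by
        refine LinearMap.ext fun p => Prod.ext ?_ (LinearMap.ext fun x => ?_)
        · simp [inducedStep, add_mul]
        · simp [inducedStep, add_mul]; abel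
      map_smul' := fun c y => by
        refine LinearMap.ext fun p => Prod.ext ?_ (LinearMap.ext fun x => ?_)
        · simp [inducedStep]
        · simp [inducedStep]
      map_lie' := fun {y z} => by
        rw [LieRing.of_associative_ring_bracket]
        exact inducedStep_lie hdec hn y z }

theorem inducedPair_ι_mul (hdec : ∀ x, (pn x : L) + pb x = x) (hn : ∀ y : n, pn y = y) (y : n)
    (u : U) (p : U × (L →ₗ[R] U)) :
    inducedPair hdec hn (UniversalEnvelopingAlgebra.ι R y * u) p =
      inducedStep n pn pb y (inducedPair hdec hn u p) := by
  rw [map_mul, inducedPair, UniversalEnvelopingAlgebra.lift_ι_apply]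
  rfl

theorem inducedPair_fst (hdec : ∀ x, (pn x : L) + pb x = x) (hn : ∀ y : n, pn y = y)
    (u : U) (p : U × (L →ₗ[R] U)) : (inducedPair hdec hn u p).1 = u * p.1 := by
  induction u using envelopingAlgebra_induction generalizing p with
  | halg r => simp [Algebra.smul_def]
  | hι x =>
    rw [inducedPair, UniversalEnvelopingAlgebra.lift_ι_apply]
    rfl
  | hadd a b ha hb => rw [map_add, LinearMap.add_apply, Prod.fst_add, ha, hb, add_mul]
  | hmul a b ha hb => rw [map_mul, Module.End.mul_apply, ha, hb, mul_assoc]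

/-- The action of `x ∈ L` on the induced module, realised on the enveloping algebra of `𝔫`. -/
def inducedAct (hdec : ∀ x, (pn x : L) + pb x = x) (hn : ∀ y : n, pn y = y) (χ : L →ₗ[R] R) :
    L →ₗ[R] Module.End R U :=
  LinearMap.mk₂ R (fun x u => UniversalEnvelopingAlgebra.ι R (pn x) * u +
      (inducedPair hdec hn u (1, (Algebra.linearMap R U).comp χ)).2 (pb x))
    (fun x x' u => by simp only [map_add, add_mul]; abel)
    (fun c x u => by simp only [map_smul, smul_mul_assoc, smul_add])
    (fun x u u' => by
      simp only [map_add, mul_add, LinearMap.add_apply, Prod.snd_add]; abel)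
    (fun c x u => by
      simp only [map_smul, mul_smul_comm, LinearMap.smul_apply, Prod.smul_snd, smul_add])

theorem inducedAct_apply_of_mem (hdec : ∀ x, (pn x : L) + pb x = x) (hn : ∀ y : n, pn y = y)
    (χ : L →ₗ[R] R) (y : n) (u : U) :
    inducedAct hdec hn χ y u = UniversalEnvelopingAlgebra.ι R y * u := by
  have hb : pb y = 0 := by
    have := hdec y
    rwa [hn, add_eq_left] at this
  simp [inducedAct, hb, hn]

theorem inducedAct_apply_of_pn_eq_zero (hdec : ∀ x, (pn x : L) + pb x = x)
    (hn : ∀ y : n, pn y = y) (χ : L →ₗ[R] R) {x : L} (hx : pn x = 0) (u : U) :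
    inducedAct hdec hn χ x u =
      (inducedPair hdec hn u (1, (Algebra.linearMap R U).comp χ)).2 x := by
  have hb : pb x = x := by
    have := hdec x
    rwa [hx, ZeroMemClass.coe_zero, zero_add] at this
  simp [inducedAct, hx, hb]

theorem inducedAct_one (hdec : ∀ x, (pn x : L) + pb x = x) (hn : ∀ y : n, pn y = y)
    (χ : L →ₗ[R] R) {x : L} (hx : pn x = 0) :
    inducedAct hdec hn χ x 1 = algebraMap R U (χ x) := by
  rw [inducedAct_apply_of_pn_eq_zero hdec hn χ hx, map_one]
  rfl

/-- The relation `x y u = y x u + [x, y] u` of the induced module, which `inducedStep` was designed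
to encode. -/
theorem inducedAct_ι_mul (hdec : ∀ x, (pn x : L) + pb x = x) (hn : ∀ y : n, pn y = y)
    (χ : L →ₗ[R] R) {x : L} (hx : pn x = 0) (y : n) (u : U) :
    inducedAct hdec hn χ x (UniversalEnvelopingAlgebra.ι R y * u) =
      UniversalEnvelopingAlgebra.ι R y * inducedAct hdec hn χ x u +
        inducedAct hdec hn χ ⁅x, (y : L)⁆ u := by
  rw [inducedAct_apply_of_pn_eq_zero hdec hn χ hx, inducedAct_apply_of_pn_eq_zero hdec hn χ hx,
    inducedPair_ι_mul]
  conv_lhs => simp only [inducedStep, LinearMap.coe_mk, AddHom.coe_mk]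
  rw [inducedPair_fst, mul_one, add_assoc]
  rfl

/-- Splitting both arguments along `𝔫 ⊕ 𝔟` leaves four cases. Those involving `𝔫` are left
multiplication or `inducedAct_ι_mul`; the case of two elements of `𝔟` needs an induction on the
vector acted upon. -/
theorem inducedAct_lie (hdec : ∀ x, (pn x : L) + pb x = x) (hn : ∀ y : n, pn y = y)
    (χ : L →ₗ[R] R) (hlie : ∀ x y : L, pn x = 0 → pn y = 0 → pn ⁅x, y⁆ = 0)
    (hχ : ∀ x y : L, pn x = 0 → pn y = 0 → χ ⁅x, y⁆ = 0) (x y : L) :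
    inducedAct hdec hn χ ⁅x, y⁆ = inducedAct hdec hn χ x * inducedAct hdec hn χ y -
      inducedAct hdec hn χ y * inducedAct hdec hn χ x := by
  set σ := inducedAct hdec hn χ with hσ
  have hpb : ∀ x, pn (pb x) = 0 := fun x => by
    have := congrArg pn (hdec x)
    rwa [map_add, hn, add_eq_left] at this
  have hnn : ∀ y z : n, σ ⁅(y : L), (z : L)⁆ = σ y * σ z - σ z * σ y := fun y z => by
    ext u
    have := inducedAct_apply_of_mem hdec hn χ ⁅y, z⁆ u
    rw [LieSubalgebra.coe_bracket, ← hσ] at this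
    simp only [this, LinearMap.sub_apply, Module.End.mul_apply]
    simp only [hσ, inducedAct_apply_of_mem, ι_lie]
    noncomm_ring
  have hbn : ∀ x (y : n), pn x = 0 → σ ⁅x, (y : L)⁆ = σ x * σ y - σ y * σ x := fun x y hx => by
    ext u
    simp only [LinearMap.sub_apply, Module.End.mul_apply]
    simp only [hσ, inducedAct_apply_of_mem, inducedAct_ι_mul hdec hn χ hx]
    abel
  have hbb : ∀ x x', pn x = 0 → pn x' = 0 → σ ⁅x, x'⁆ = σ x * σ x' - σ x' * σ x := by
    let S : Submodule R U :=
      { carrier := {u | ∀ x x', pn x = 0 → pn x' = 0 →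
          σ ⁅x, x'⁆ u = σ x (σ x' u) - σ x' (σ x u)}
        add_mem' := fun {u w} hu hw x x' hx hx' => by
          simp only [map_add, hu x x' hx hx', hw x x' hx hx']; abel
        zero_mem' := fun x x' _ _ => by simp only [map_zero, sub_zero]
        smul_mem' := fun c u hu x x' hx hx' => by
          simp only [map_smul, hu x x' hx hx', smul_sub] }
    have hS : S = ⊤ := by
      refine eq_top_of_one_mem_of_ι_mul_mem S ?_ ?_
      -- On the generator both orders give the scalar `χ x * χ x'`, and `χ` kills brackets of
      -- elements of `𝔟`.
      · intro x x' hx hx'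
        have hc : ∀ (z : L) (r : R), pn z = 0 → σ z (algebraMap R U r) = algebraMap R U (r * χ z) :=
          fun z r hz => by
            rw [Algebra.algebraMap_eq_smul_one, map_smul, hσ, inducedAct_one hdec hn χ hz, map_mul,
              Algebra.smul_def]
        have h1 : ∀ z, pn z = 0 → σ z 1 = algebraMap R U (χ z) :=
          fun z hz => inducedAct_one hdec hn χ hz
        rw [h1 _ (hlie x x' hx hx'), h1 _ hx, h1 _ hx', hc _ _ hx, hc _ _ hx', hχ x x' hx hx',
          mul_comm (χ x'), sub_self, map_zero]
      · intro y u hu x x' hx hx'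
        -- The bracket `⁅x, y⁆` may leave `𝔟`, so the induction hypothesis is extended to an
        -- arbitrary first argument, its `𝔫`-component being covered by `hbn`.
        have hu' : ∀ (z x' : L), pn x' = 0 → σ ⁅z, x'⁆ u = σ z (σ x' u) - σ x' (σ z u) := by
          intro z x' hx'
          have h1 := hu (pb z) x' (hpb z) hx'
          have h2 := DFunLike.congr_fun (hbn x' (pn z) hx') u
          rw [LinearMap.sub_apply, Module.End.mul_apply, Module.End.mul_apply, ← lie_skew,
            map_neg, LinearMap.neg_apply] at h2
          rw [← hdec z, add_lie, map_add, LinearMap.add_apply, h1, map_add, LinearMap.add_apply,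
            LinearMap.add_apply, map_add, eq_comm, ← sub_eq_zero]
          rw [neg_eq_iff_eq_neg] at h2
          rw [h2]
          abel
        rw [hσ, inducedAct_ι_mul hdec hn χ (hlie x x' hx hx'), inducedAct_ι_mul hdec hn χ hx,
          inducedAct_ι_mul hdec hn χ hx', map_add, map_add, inducedAct_ι_mul hdec hn χ hx,
          inducedAct_ι_mul hdec hn χ hx', ← hσ, hu x x' hx hx',
          show ⁅⁅x, x'⁆, (y : L)⁆ = ⁅⁅x, (y : L)⁆, x'⁆ - ⁅⁅x', (y : L)⁆, x⁆ by
            rw [lie_lie, ← lie_skew ⁅x, (y : L)⁆, ← lie_skew ⁅x', (y : L)⁆]; abel,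
          map_sub, LinearMap.sub_apply, hu' _ _ hx, hu' _ _ hx']
        noncomm_ring
    intro x x' hx hx'
    ext u
    exact (hS ▸ Submodule.mem_top : u ∈ S) x x' hx hx'
  have hnb : ∀ (y : n) x, pn x = 0 → σ ⁅(y : L), x⁆ = σ y * σ x - σ x * σ y := fun y x hx => by
    rw [← lie_skew, map_neg, hbn x y hx, neg_sub]
  rw [← hdec x, ← hdec y, add_lie, lie_add, lie_add, map_add, map_add, map_add, hnn,
    hbn _ _ (hpb x), hnb _ _ (hpb y), hbb _ _ (hpb x) (hpb y), map_add, map_add]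
  noncomm_ring

/-- For a decomposition `L = 𝔫 ⊕ 𝔟` into subalgebras and a character `χ` of `𝔟`, the projection of
the induced module `U(L) ⊗_{U(𝔟)} χ` onto the line of its generator along the image of `𝔫`. -/
theorem exists_inducedFunctional (n b : LieSubalgebra R L)
    (hc : IsCompl n.toSubmodule b.toSubmodule) (χ : L →ₗ[R] R)
    (hχ : ∀ x ∈ b, ∀ y ∈ b, χ ⁅x, y⁆ = 0) :
    ∃ ε : UniversalEnvelopingAlgebra R L →ₗ[R] R, ε 1 = 1 ∧
      (∀ w, ∀ x ∈ b, ε (w * UniversalEnvelopingAlgebra.ι R x) = χ x * ε w) ∧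
      ∀ y ∈ n, ∀ w, ε (UniversalEnvelopingAlgebra.ι R y * w) = 0 := by
  let pn : L →ₗ[R] n := n.toSubmodule.projectionOnto b.toSubmodule hc
  let pb : L →ₗ[R] L := LinearMap.id - n.toSubmodule.subtype ∘ₗ pn
  have hdec : ∀ x, (pn x : L) + pb x = x := fun x => by simp [pb]
  have hn : ∀ y : n, pn y = y := fun y => Submodule.projectionOnto_apply_left hc y
  have hker : ∀ x, pn x = 0 ↔ x ∈ b := fun x => Submodule.projectionOnto_apply_eq_zero_iff hc
  let σ : L →ₗ⁅R⁆ Module.End R (UniversalEnvelopingAlgebra R n) :=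
    { inducedAct hdec hn χ with
      map_lie' := fun {x y} => by
        rw [LieRing.of_associative_ring_bracket]
        refine inducedAct_lie hdec hn χ (fun x y hx hy => ?_) (fun x y hx hy => ?_) x y
        · rw [hker] at *
          exact b.lie_mem hx hy
        · rw [hker] at *
          exact hχ x hx y hy }
  let aug : UniversalEnvelopingAlgebra R n →ₐ[R] R := UniversalEnvelopingAlgebra.lift R 0
  let act := UniversalEnvelopingAlgebra.lift R σ
  have hact : ∀ x, act (UniversalEnvelopingAlgebra.ι R x) = inducedAct hdec hn χ x := fun x =>
    UniversalEnvelopingAlgebra.lift_ι_apply R σ x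
  -- `ε w` is the augmentation of `w` applied to the generator; the augmentation kills `𝔫 U(𝔫)`.
  refine ⟨aug.toLinearMap ∘ₗ LinearMap.applyₗ 1 ∘ₗ act.toLinearMap, ?_, ?_, ?_⟩
  · simp
  · intro w x hx
    simp only [LinearMap.comp_apply, AlgHom.toLinearMap_apply, LinearMap.applyₗ_apply_apply,
      map_mul, Module.End.mul_apply, hact]
    rw [inducedAct_one hdec hn χ ((hker x).mpr hx), Algebra.algebraMap_eq_smul_one, map_smul,
      map_smul, smul_eq_mul]
  · intro y hy w
    simp only [LinearMap.comp_apply, AlgHom.toLinearMap_apply, LinearMap.applyₗ_apply_apply,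
      map_mul, Module.End.mul_apply, hact]
    rw [inducedAct_apply_of_mem hdec hn χ ⟨y, hy⟩, map_mul]
    simp only [aug, UniversalEnvelopingAlgebra.lift_ι_apply]
    simp

end InducedFunctional

/-- If subspaces of eigenspaces span, then each eigenspace is spanned by the subspaces belonging
to its eigenvalue. -/
theorem eigenspace_le_iSup_of_iSup_eq_top {V ι : Type*} [AddCommGroup V] [Module ℂ V]
    (f : Module.End ℂ V) (E : ι → Submodule ℂ V) (μ : ι → ℂ) (hE : ∀ i, E i ≤ f.eigenspace (μ i))
    (htop : ⨆ i, E i = ⊤) (c : ℂ) : f.eigenspace c ≤ ⨆ i, ⨆ _ : μ i = c, E i := by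
  intro w hw
  -- Separate the summands with eigenvalue `c` from the rest. The second component of `w` then also
  -- has eigenvalue `c`, so it vanishes by independence of eigenspaces.
  have hle : (⊤ : Submodule ℂ V) ≤
      (⨆ i, ⨆ _ : μ i = c, E i) ⊔ ⨆ c', ⨆ _ : c' ≠ c, f.eigenspace c' := by
    rw [← htop, iSup_le_iff]
    intro i
    by_cases h : μ i = c
    · exact le_sup_of_le_left (le_iSup₂_of_le i h le_rfl)
    · exact le_sup_of_le_right (le_iSup₂_of_le (μ i) h (hE i))
  obtain ⟨a, ha, z, hz, rfl⟩ := Submodule.mem_sup.mp (hle (Submodule.mem_top (x := w)))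
  have ha' : a ∈ f.eigenspace c :=
    (iSup₂_le fun i h => (hE i).trans_eq (h ▸ rfl) :
      (⨆ i, ⨆ _ : μ i = c, E i) ≤ f.eigenspace c) ha
  have hz' : z ∈ f.eigenspace c := by simpa using Submodule.sub_mem _ hw ha'
  have := Submodule.disjoint_def.mp (f.eigenspaces_iSupIndep c) z hz' hz
  rw [this, add_zero]
  exact ha

/-! ### Highest weight modules over a Lie algebra graded by an element `d` -/

section Graded

variable {L : Type*} [LieRing L] [LieAlgebra ℂ L] (d : L)

/-- The homogeneous elements of degree `k` for the grading of `L` by the eigenvalues of `ad d`. -/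
def grade (k : ℤ) : Submodule ℂ L := (LieAlgebra.ad ℂ L d).eigenspace (k : ℂ)

variable {d}

theorem mem_grade {k : ℤ} {x : L} : x ∈ grade d k ↔ ⁅d, x⁆ = (k : ℂ) • x := by
  rw [grade, Module.End.mem_eigenspace_iff, LieAlgebra.ad_apply]

theorem lie_mem_grade {j k : ℤ} {x y : L} (hx : x ∈ grade d j) (hy : y ∈ grade d k) :
    ⁅x, y⁆ ∈ grade d (j + k) := by
  rw [mem_grade] at *
  rw [leibniz_lie, hx, hy, smul_lie, lie_smul, ← add_smul, Int.cast_add]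

theorem ι_lie_smul {V : Type*} [AddCommGroup V] [Module (UniversalEnvelopingAlgebra ℂ L) V] (x y : L) (w : V) : UniversalEnvelopingAlgebra.ι ℂ ⁅x, y⁆ • w =
    UniversalEnvelopingAlgebra.ι ℂ x • UniversalEnvelopingAlgebra.ι ℂ y • w -
      UniversalEnvelopingAlgebra.ι ℂ y • UniversalEnvelopingAlgebra.ι ℂ x • w := by
  rw [ι_lie, sub_smul, mul_smul, mul_smul]

variable {V : Type*} [AddCommGroup V] [Module ℂ V] [Module (UniversalEnvelopingAlgebra ℂ L) V] [IsScalarTower ℂ (UniversalEnvelopingAlgebra ℂ L) V]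

variable (V) in
/-- The action of `L` on a module over its enveloping algebra. -/
def lieAct : L →ₗ[ℂ] Module.End ℂ V :=
  LinearMap.mk₂ ℂ (fun x w => UniversalEnvelopingAlgebra.ι ℂ x • w)
    (fun x y w => by rw [map_add, add_smul])
    (fun c x w => by rw [map_smul, smul_assoc])
    (fun x w w' => smul_add _ _ _)
    (fun c x w => smul_comm _ _ _)

theorem lieAct_apply (x : L) (w : V) : lieAct V x w = UniversalEnvelopingAlgebra.ι ℂ x • w := rfl

theorem lieAct_lie (x y : L) (w : V) :
    lieAct V ⁅x, y⁆ w = lieAct V x (lieAct V y w) - lieAct V y (lieAct V x w) :=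
  ι_lie_smul x y w

/-- A subspace stable under `L`, as a submodule over the enveloping algebra. -/
def envSubmodule (W : Submodule ℂ V) (h : ∀ (x : L), ∀ w ∈ W, lieAct V x w ∈ W) :
    Submodule (UniversalEnvelopingAlgebra ℂ L) V where
  toAddSubmonoid := W.toAddSubmonoid
  smul_mem' u w hw := by
    induction u using envelopingAlgebra_induction generalizing w with
    | halg r =>
      rw [algebraMap_smul]
      exact W.smul_mem r hw
    | hι x => exact h x w hw
    | hadd a b ha hb =>
      rw [add_smul]
      exact W.add_mem (ha w hw) (hb w hw)
    | hmul a b ha hb =>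
      rw [mul_smul]
      exact ha _ (hb w hw)

@[simp] theorem mem_envSubmodule {W : Submodule ℂ V} {h : ∀ (x : L), ∀ w ∈ W, lieAct V x w ∈ W} {w : V} :
    w ∈ envSubmodule W h ↔ w ∈ W := Iff.rfl

variable (d) in
/-- The vectors obtained from `S` by applying homogeneous elements of negative degree, of total
degree `-m`. -/
inductive Descends (S : Submodule ℂ V) : ℤ → V → Prop
  | base {w : V} (hw : w ∈ S) : Descends S 0 w
  | step {m i : ℤ} {y : L} {w : V} (hi : 0 < i) (hy : y ∈ grade d (-i)) (hw : Descends S m w) :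
      Descends S (m + i) (lieAct V y w)

variable (d) in
/-- The span of the vectors of depth `m` below `S`. -/
def depth (S : Submodule ℂ V) (m : ℤ) : Submodule ℂ V := Submodule.span ℂ {w | Descends d S m w}

variable {S : Submodule ℂ V}

theorem Descends.nonneg {m : ℤ} {w : V} (h : Descends d S m w) : 0 ≤ m := by
  induction h with
  | base => exact le_rfl
  | step hi _ _ ih => omega

theorem Descends.mem_depth {m : ℤ} {w : V} (h : Descends d S m w) : w ∈ depth d S m :=
  Submodule.subset_span h

theorem depth_zero_le : depth d S 0 ≤ S := by
  refine Submodule.span_le.mpr fun w hw => ?_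
  have : ∀ m w, Descends d S m w → m = 0 → w ∈ S := by
    intro m w h
    cases h with
    | base hw => exact fun _ => hw
    | step hi _ hw => have := hw.nonneg; intro; omega
  exact this 0 w hw rfl

theorem depth_eq_bot_of_neg {m : ℤ} (hm : m < 0) : depth d S m = ⊥ := by
  rw [depth, Submodule.span_eq_bot]
  intro w hw
  have := Descends.nonneg hw
  omega

theorem lieAct_neg_mem_depth {m i : ℤ} (hi : 0 < i) {y : L} (hy : y ∈ grade d (-i)) {w : V}
    (hw : w ∈ depth d S m) : lieAct V y w ∈ depth d S (m + i) := by
  induction hw using Submodule.span_induction with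
  | mem w hw => exact (Descends.step hi hy hw).mem_depth
  | zero => rw [map_zero]; exact zero_mem _
  | add a b _ _ ha hb => rw [map_add]; exact add_mem ha hb
  | smul c a _ ha => rw [map_smul]; exact Submodule.smul_mem _ c ha

/-- Induction on the word of lowering operators, through `x y w = [x, y] w + y x w`. `S` is kept
general because the result serves both for the highest weight line and for spaces of singular
vectors. -/
theorem lieAct_mem_depth (h0 : ∀ x ∈ grade d 0, ∀ w ∈ S, lieAct V x w ∈ S)
    (hpos : ∀ k, 0 < k → ∀ x ∈ grade d k, ∀ w ∈ S, lieAct V x w = 0) {m j : ℤ} {x : L}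
    (hx : x ∈ grade d j) {w : V} (hw : w ∈ depth d S m) : lieAct V x w ∈ depth d S (m - j) := by
  have key : ∀ {m w}, Descends d S m w → ∀ {j : ℤ} {x : L}, x ∈ grade d j →
      lieAct V x w ∈ depth d S (m - j) := by
    intro m w h
    induction h with
    | base hw =>
      intro j x hx
      rcases lt_trichotomy j 0 with hj | rfl | hj
      · rw [sub_eq_add_neg]
        exact lieAct_neg_mem_depth (by omega) (by rwa [neg_neg]) (Descends.base hw).mem_depth
      · rw [sub_zero]
        exact (Descends.base (h0 x hx _ hw)).mem_depth
      · rw [hpos j hj x hx _ hw]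
        exact zero_mem _
    | @step m i y w hi hy hw ih =>
      intro j x hx
      have h1 := lieAct_neg_mem_depth hi hy (ih hx)
      have h2 := ih (lie_mem_grade hx hy)
      rw [lieAct_lie] at h2
      have h3 := add_mem h2 (show _ ∈ depth d S (m - (j + -i)) from
        (by convert h1 using 2; ring : lieAct V y (lieAct V x w) ∈ depth d S (m - (j + -i))))
      rw [sub_add_cancel] at h3
      convert h3 using 2
      ring
  induction hw using Submodule.span_induction with
  | mem w hw => exact key hw hx
  | zero => rw [map_zero]; exact zero_mem _
  | add a b _ _ ha hb => rw [map_add]; exact add_mem ha hb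
  | smul c a _ ha => rw [map_smul]; exact Submodule.smul_mem _ c ha

theorem lieAct_mem_iSup_depth (hd : ⨆ k, grade d k = ⊤)
    (h0 : ∀ x ∈ grade d 0, ∀ w ∈ S, lieAct V x w ∈ S)
    (hpos : ∀ k, 0 < k → ∀ x ∈ grade d k, ∀ w ∈ S, lieAct V x w = 0) (x : L) (w : V)
    (hw : w ∈ ⨆ m, depth d S m) : lieAct V x w ∈ ⨆ m, depth d S m := by
  have hx : x ∈ ⨆ k, grade d k := hd ▸ Submodule.mem_top
  induction hw using Submodule.iSup_induction' with
  | mem m w hw =>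
    induction hx using Submodule.iSup_induction' with
    | mem k x hx => exact Submodule.mem_iSup_of_mem _ (lieAct_mem_depth h0 hpos hx hw)
    | zero => rw [map_zero]; exact zero_mem _
    | add a b _ _ ha hb => rw [map_add]; exact add_mem ha hb
  | zero => rw [map_zero]; exact zero_mem _
  | add a b _ _ ha hb => rw [map_add]; exact add_mem ha hb

theorem depth_le_eigenspace {c : ℂ} (hS : S ≤ (lieAct V d).eigenspace c) (m : ℤ) :
    depth d S m ≤ (lieAct V d).eigenspace (c - m) := by
  refine Submodule.span_le.mpr fun w (hD : Descends d S m w) => ?_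
  induction hD with
  | base hw => simpa using hS hw
  | @step m i y w hi hy hw ih =>
    have ih := Module.End.mem_eigenspace_iff.mp ih
    have h := lieAct_lie d y w
    rw [mem_grade.mp hy, ih] at h
    refine Module.End.mem_eigenspace_iff.mpr ?_
    rw [eq_sub_iff_add_eq] at h
    rw [← h, map_smul, map_smul, LinearMap.smul_apply, ← add_smul]
    push_cast
    congr 1
    ring

/-- Peeling off the outermost operator bounds depth `m` by `S` and finitely many products of degree
`-i` operators with depth `m - i`, where `1 ≤ i ≤ m`. Only the image of each graded piece in `End V`
has to be finite-dimensional, since the pieces of `τ(A)` themselves may be infinite-dimensional. -/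
theorem finiteDimensional_depth [FiniteDimensional ℂ S]
    (hfin : ∀ i : ℤ, 0 < i → FiniteDimensional ℂ ((grade d (-i)).map (lieAct V))) (m : ℤ) :
    FiniteDimensional ℂ (depth d S m) := by
  suffices h : ∀ k : ℕ, ∀ m : ℤ, m < k → FiniteDimensional ℂ (depth d S m) from
    h (m.toNat + 1) m (by omega)
  intro k
  induction k with
  | zero =>
    intro m hm
    rw [depth_eq_bot_of_neg (by exact_mod_cast hm)]
    infer_instance
  | succ k ih =>
    intro m hm
    have hsub : depth d S m ≤ S ⊔ ⨆ i : Finset.Icc (1 : ℤ) m,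
        Submodule.map₂ (LinearMap.id : Module.End ℂ V →ₗ[ℂ] V →ₗ[ℂ] V)
          ((grade d (-(i : ℤ))).map (lieAct V)) (depth d S (m - i)) := by
      refine Submodule.span_le.mpr fun w (hD : Descends d S m w) => ?_
      cases hD with
      | base hw => exact Submodule.mem_sup_left hw
      | @step m i y w hi hy hw =>
        have := hw.nonneg
        refine Submodule.mem_sup_right (Submodule.mem_iSup_of_mem
          ⟨i, Finset.mem_Icc.mpr ⟨by omega, by omega⟩⟩ ?_)
        refine Submodule.apply_mem_map₂ (LinearMap.id : Module.End ℂ V →ₗ[ℂ] V →ₗ[ℂ] V)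
          (Submodule.mem_map_of_mem hy) ?_
        simpa using hw.mem_depth
    have : ∀ i : Finset.Icc (1 : ℤ) m, FiniteDimensional ℂ
        (Submodule.map₂ (LinearMap.id : Module.End ℂ V →ₗ[ℂ] V →ₗ[ℂ] V)
          ((grade d (-(i : ℤ))).map (lieAct V)) (depth d S (m - i)) : Submodule ℂ V) := by
      intro i
      have hi := Finset.mem_Icc.mp i.2
      have := hfin i (by omega)
      have := ih (m - i) (by push_cast at hm; omega)
      have h1 := (Submodule.fg_iff_finiteDimensional _).mpr (hfin i (by omega))
      have h2 := (Submodule.fg_iff_finiteDimensional _).mpr this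
      exact (Submodule.fg_iff_finiteDimensional _).mp (Submodule.FG.map₂ _ h1 h2)
    exact Submodule.finiteDimensional_of_le hsub

/-- `v` generates `V`, is killed by the elements of positive degree, and is a common eigenvector of
the elements of degree zero with eigenvalues given by `χ`. -/
structure IsHighestWeight (d : L) (χ : L →ₗ[ℂ] ℂ) (v : V) : Prop where
  generates : Submodule.span (UniversalEnvelopingAlgebra ℂ L) {v} = ⊤
  pos : ∀ k, 0 < k → ∀ x ∈ grade d k, lieAct V x v = 0
  zero : ∀ x ∈ grade d 0, lieAct V x v = χ x • v

namespace IsHighestWeight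

variable {χ : L →ₗ[ℂ] ℂ} {v : V}

theorem span_le_eigenspace (h : IsHighestWeight d χ v) :
    Submodule.span ℂ {v} ≤ (lieAct V d).eigenspace (χ d) := by
  rw [Submodule.span_singleton_le_iff_mem, Module.End.mem_eigenspace_iff]
  exact h.zero d (mem_grade.mpr (by simp))

/-- The sum of the depth spaces is stable under `L` and contains the generator. This replaces the
factorisation of `U(L)` coming from the triangular decomposition. -/
theorem iSup_depth_eq_top (h : IsHighestWeight d χ v) (hd : ⨆ k, grade d k = ⊤) :
    ⨆ m, depth d (Submodule.span ℂ {v}) m = ⊤ := by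
  have h0 : ∀ x ∈ grade d 0, ∀ w ∈ Submodule.span ℂ {v},
      lieAct V x w ∈ Submodule.span ℂ {v} := by
    intro x hx w hw
    obtain ⟨c, rfl⟩ := Submodule.mem_span_singleton.mp hw
    rw [map_smul, h.zero x hx, smul_smul]
    exact Submodule.smul_mem _ _ (Submodule.mem_span_singleton_self v)
  have hpos : ∀ k, 0 < k → ∀ x ∈ grade d k, ∀ w ∈ Submodule.span ℂ {v}, lieAct V x w = 0 := by
    intro k hk x hx w hw
    obtain ⟨c, rfl⟩ := Submodule.mem_span_singleton.mp hw
    rw [map_smul, h.pos k hk x hx, smul_zero]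
  let N : Submodule (UniversalEnvelopingAlgebra ℂ L) V := envSubmodule _ (lieAct_mem_iSup_depth hd h0 hpos)
  have hN : (⊤ : Submodule (UniversalEnvelopingAlgebra ℂ L) V) ≤ N := by
    rw [← h.generates, Submodule.span_singleton_le_iff_mem, mem_envSubmodule]
    exact Submodule.mem_iSup_of_mem 0
      (Descends.base (Submodule.mem_span_singleton_self v)).mem_depth
  exact eq_top_iff.mpr fun w _ => hN (Submodule.mem_top (x := w))

/-- A functional that takes the value `1` at `v` and kills everything of negative degree vanishes
on all proper submodules. -/
theorem apply_eq_zero_of_mem_of_ne_top (h : IsHighestWeight d χ v) (hd : ⨆ k, grade d k = ⊤)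
    {ε : V →ₗ[ℂ] ℂ} (hv : ε v = 1)
    (hneg : ∀ i, 0 < i → ∀ y ∈ grade d (-i), ∀ w, ε (lieAct V y w) = 0)
    {N : Submodule (UniversalEnvelopingAlgebra ℂ L) V} (hN : N ≠ ⊤) {w : V} (hw : w ∈ N) : ε w = 0 := by
  have hdepth : ∀ m, 0 < m → ∀ w ∈ depth d (Submodule.span ℂ {v}) m, ε w = 0 := by
    intro m hm w hw
    induction hw using Submodule.span_induction with
    | mem w hw =>
      have hD : Descends d _ m w := hw
      cases hD with
      | base => exact absurd hm (lt_irrefl _)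
      | step hi hy _ => exact hneg _ hi _ hy _
    | zero => exact map_zero _
    | add a b _ _ ha hb => rw [map_add, ha, hb, add_zero]
    | smul c a _ ha => rw [map_smul, ha, smul_zero]
  have hw' : w ∈ Submodule.span ℂ {v} ⊔
      ⨆ m : ℤ, ⨆ _ : 0 < m, depth d (Submodule.span ℂ {v}) m := by
    refine (?_ : (⊤ : Submodule ℂ V) ≤ _) Submodule.mem_top
    rw [← h.iSup_depth_eq_top hd, iSup_le_iff]
    intro m
    rcases lt_trichotomy m 0 with hm | rfl | hm
    · rw [depth_eq_bot_of_neg hm]; exact bot_le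
    · exact le_sup_of_le_left depth_zero_le
    · exact le_sup_of_le_right (le_iSup₂_of_le m hm le_rfl)
  obtain ⟨a, ha, z, hz, rfl⟩ := Submodule.mem_sup.mp hw'
  have hεz : ε z = 0 := by
    have : (⨆ m : ℤ, ⨆ _ : 0 < m, depth d (Submodule.span ℂ {v}) m) ≤ LinearMap.ker ε :=
      iSup₂_le fun m hm w hw => hdepth m hm w hw
    exact this hz
  -- Eigenvalues of `d` are compared in `V ⧸ N`: the images of `a` and `-z` agree but lie in
  -- independent sums of eigenspaces, so `a ∈ N`. As `a` is a multiple of `v` and `N` is proper, `a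
  -- = 0`.
  let q : V →ₗ[ℂ] V ⧸ N := (Submodule.mkQ N).restrictScalars ℂ
  have hq : ∀ c : ℂ, (lieAct V d).eigenspace c ≤
      ((lieAct (V ⧸ N) d).eigenspace c).comap q := by
    intro c w hw
    rw [Submodule.mem_comap, Module.End.mem_eigenspace_iff]
    rw [Module.End.mem_eigenspace_iff] at hw
    change UniversalEnvelopingAlgebra.ι ℂ d • Submodule.Quotient.mk (p := N) w = _
    rw [← Submodule.Quotient.mk_smul, ← lieAct_apply, hw]
    rfl
  have hqa : q a ∈ (lieAct (V ⧸ N) d).eigenspace (χ d) := hq _ (h.span_le_eigenspace ha)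
  have hqz : q z ∈ ⨆ c, ⨆ _ : c ≠ χ d, (lieAct (V ⧸ N) d).eigenspace c := by
    have : (⨆ m : ℤ, ⨆ _ : 0 < m, depth d (Submodule.span ℂ {v}) m) ≤
        (⨆ c, ⨆ _ : c ≠ χ d, (lieAct (V ⧸ N) d).eigenspace c).comap q := by
      refine iSup₂_le fun m hm => (depth_le_eigenspace h.span_le_eigenspace m).trans
        ((hq _).trans (Submodule.comap_mono (le_iSup₂_of_le (χ d - m) ?_ le_rfl)))
      rw [Ne, sub_eq_self, Int.cast_eq_zero]
      exact hm.ne'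
    exact this hz
  have hqaz : q a = -q z := by
    rw [eq_neg_iff_add_eq_zero, ← map_add]
    exact (Submodule.Quotient.mk_eq_zero N).mpr hw
  have hqa0 : q a = 0 := Submodule.disjoint_def.mp
    ((lieAct (V ⧸ N) d).eigenspaces_iSupIndep (χ d)) _ hqa (hqaz ▸ Submodule.neg_mem _ hqz)
  have haN : a ∈ N := (Submodule.Quotient.mk_eq_zero N).mp hqa0
  obtain ⟨c, rfl⟩ := Submodule.mem_span_singleton.mp ha
  rw [map_add, map_smul, hv, hεz, add_zero, smul_eq_mul, mul_one]
  by_contra hc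
  refine hN (eq_top_iff.mpr ?_)
  rw [← h.generates, Submodule.span_singleton_le_iff_mem]
  have := N.smul_mem (algebraMap ℂ (UniversalEnvelopingAlgebra ℂ L) c⁻¹) haN
  rwa [algebraMap_smul, smul_smul, inv_mul_cancel₀ hc, one_smul] at this

/-- In an irreducible highest weight module, a graded ideal on whose degree zero part the highest
weight vanishes acts trivially. -/
theorem lieAct_eq_zero_of_mem_ideal (h : IsHighestWeight d χ v) (hd : ⨆ k, grade d k = ⊤)
    (hirr : ∀ N : Submodule (UniversalEnvelopingAlgebra ℂ L) V, N ≠ ⊤ → N = ⊥) (J : LieIdeal ℂ L)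
    (hJ : J.toSubmodule ≤ ⨆ k, J.toSubmodule ⊓ grade d k) (hχ : ∀ x ∈ J, x ∈ grade d 0 → χ x = 0)
    {x : L} (hx : x ∈ J) (w : V) : lieAct V x w = 0 := by
  let W : Submodule ℂ V :=
    { carrier := {w | ∀ x : L, x ∈ J → lieAct V x w = 0}
      add_mem' := fun ha hb x hx => by rw [map_add, ha x hx, hb x hx, add_zero]
      zero_mem' := fun x _ => map_zero _
      smul_mem' := fun c a ha x hx => by rw [map_smul, ha x hx, smul_zero] }
  have hW : ∀ (x : L), ∀ w ∈ W, lieAct V x w ∈ W := by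
    intro x w hw y hy
    have h1 := lieAct_lie y x w
    rw [hw y hy, map_zero, sub_zero, hw _ (lie_mem_left ℂ L J y x hy)] at h1
    exact h1.symm
  -- For `y` of positive degree, `y x v = [y, x] v` with `[y, x]` in `J` and of higher degree than
  -- `x`, so strong induction shows that `x v` is singular.
  have hvneg : ∀ m : ℕ, ∀ x ∈ J, x ∈ grade d (-(m : ℤ)) → lieAct V x v = 0 := by
    intro m
    induction m using Nat.strong_induction_on with
    | _ m ih =>
      intro x hx hxm
      rcases Nat.eq_zero_or_pos m with rfl | hm
      · rw [h.zero x (by simpa using hxm), hχ x hx (by simpa using hxm), zero_smul]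
      -- The singular vectors with eigenvalue `χ d - m`. The submodule they generate only has
      -- eigenvalues `χ d - m - m'` with `m' ≥ 0`, never `χ d`.
      let S : Submodule ℂ V := (lieAct V d).eigenspace (χ d - m) ⊓
        { carrier := {w | ∀ k, 0 < k → ∀ x ∈ grade d k, lieAct V x w = 0}
          add_mem' := fun ha hb k hk x hx => by rw [map_add, ha k hk x hx, hb k hk x hx, add_zero]
          zero_mem' := fun k hk x _ => map_zero _
          smul_mem' := fun c a ha k hk x hx => by rw [map_smul, ha k hk x hx, smul_zero] }
      have hxS : lieAct V x v ∈ S := by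
        refine ⟨?_, fun k hk y hy => ?_⟩
        · have h1 := depth_le_eigenspace h.span_le_eigenspace (0 + (m : ℤ))
            (lieAct_neg_mem_depth (by exact_mod_cast hm) hxm
              (Descends.base (Submodule.mem_span_singleton_self v)).mem_depth)
          simpa using h1
        · have h1 := lieAct_lie y x v
          rw [h.pos k hk y hy, map_zero, sub_zero] at h1
          rw [← h1]
          have h2 := lie_mem_grade hy hxm
          have h3 : ⁅y, x⁆ ∈ J := lie_mem_right ℂ L J y x hx
          by_cases hkm : 0 < k + -(m : ℤ)
          · exact h.pos _ hkm _ h2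
          -- Here `0 < k ≤ m`, so the natural-number subtraction is exact and `m - k` is smaller
          -- than `m`.
          · refine ih (m - k.toNat) (by omega) _ h3 ?_
            convert h2 using 2
            omega
      have h0 : ∀ x ∈ grade d 0, ∀ w ∈ S, lieAct V x w ∈ S := by
        intro x hx w hw
        refine ⟨?_, fun k hk y hy => ?_⟩
        · have h1 := lieAct_lie d x w
          have h2 := Module.End.mem_eigenspace_iff.mp hw.1
          rw [mem_grade.mp hx, Int.cast_zero, zero_smul, map_zero, LinearMap.zero_apply, h2, eq_comm,
            sub_eq_zero, map_smul] at h1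
          exact Module.End.mem_eigenspace_iff.mpr h1
        · have h1 := lieAct_lie y x w
          have h2 := lie_mem_grade hy hx
          rw [add_zero] at h2
          rw [hw.2 k hk y hy, map_zero, sub_zero, hw.2 k hk _ h2] at h1
          exact h1.symm
      have hpos : ∀ k, 0 < k → ∀ x ∈ grade d k, ∀ w ∈ S, lieAct V x w = 0 :=
        fun k hk x hx w hw => hw.2 k hk x hx
      let N : Submodule (UniversalEnvelopingAlgebra ℂ L) V := envSubmodule _ (lieAct_mem_iSup_depth hd h0 hpos)
      have hxN : lieAct V x v ∈ N := Submodule.mem_iSup_of_mem 0 (Descends.base hxS).mem_depth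
      by_cases hN : N = ⊤
      -- If the singular vectors generated everything, `v` would lie in the sum of the eigenspaces
      -- other than its own, so `v = 0`.
      · have hv : v ∈ ⨆ m', depth d S m' := (hN ▸ Submodule.mem_top : v ∈ N)
        have hle : (⨆ m', depth d S m') ≤ ⨆ c, ⨆ _ : c ≠ χ d, (lieAct V d).eigenspace c := by
          refine iSup_le fun m' => ?_
          rcases lt_or_ge m' 0 with hm' | hm'
          · rw [depth_eq_bot_of_neg hm']; exact bot_le
          · refine (depth_le_eigenspace inf_le_left m').trans (le_iSup₂_of_le _ ?_ le_rfl)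
            rw [Ne, sub_sub, sub_eq_self]
            have : ((m : ℤ) + m' : ℤ) ≠ 0 := by omega
            exact_mod_cast this
        have hv0 : v = 0 := Submodule.disjoint_def.mp ((lieAct V d).eigenspaces_iSupIndep (χ d)) v
          (h.span_le_eigenspace (Submodule.mem_span_singleton_self v)) (hle hv)
        rw [hv0, map_zero]
      · have := hirr N hN
        rw [this] at hxN
        exact (Submodule.mem_bot (UniversalEnvelopingAlgebra ℂ L)).mp hxN
  have hv : v ∈ W := by
    intro x hx
    have : (⨆ k, J.toSubmodule ⊓ grade d k) ≤ LinearMap.ker ((lieAct V).flip v) := by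
      refine iSup_le fun k x hx => ?_
      rw [LinearMap.mem_ker, LinearMap.flip_apply]
      rcases lt_or_ge 0 k with hk | hk
      · exact h.pos k hk x hx.2
      · refine hvneg k.natAbs x hx.1 ?_
        rw [show -(k.natAbs : ℤ) = k by omega]
        exact hx.2
    exact this (hJ hx)
  have hWtop : (⊤ : Submodule (UniversalEnvelopingAlgebra ℂ L) V) ≤ envSubmodule W hW := by
    rw [← h.generates, Submodule.span_singleton_le_iff_mem]
    exact hv
  exact hWtop (Submodule.mem_top (x := w)) x hx

/-- The eigenspaces of `d` on a highest weight module are finite-dimensional if the homogeneous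
elements of each negative degree act through a finite-dimensional space. -/
theorem finiteDimensional_eigenspace (h : IsHighestWeight d χ v) (hd : ⨆ k, grade d k = ⊤)
    (hfin : ∀ i : ℤ, 0 < i → FiniteDimensional ℂ ((grade d (-i)).map (lieAct V))) (c : ℂ) :
    FiniteDimensional ℂ ((lieAct V d).eigenspace c) := by
  have hle := eigenspace_le_iSup_of_iSup_eq_top (lieAct V d) _ _
    (depth_le_eigenspace h.span_le_eigenspace) (h.iSup_depth_eq_top hd) c
  have hf : ∀ m, FiniteDimensional ℂ (depth d (Submodule.span ℂ {v}) m) :=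
    finiteDimensional_depth hfin
  -- Different depths have different eigenvalues, so at most one depth contributes to `c`.
  by_cases hc : ∃ m : ℤ, χ d - m = c
  · obtain ⟨m, rfl⟩ := hc
    have : (⨆ i : ℤ, ⨆ _ : χ d - i = χ d - m, depth d (Submodule.span ℂ {v}) i) ≤
        depth d (Submodule.span ℂ {v}) m := by
      refine iSup₂_le fun i hi => ?_
      rw [sub_right_inj, Int.cast_inj] at hi
      rw [hi]
    exact Submodule.finiteDimensional_of_le (hle.trans this)
  · have : (⨆ i : ℤ, ⨆ _ : χ d - i = c, depth d (Submodule.span ℂ {v}) i) ≤ ⊥ :=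
      iSup₂_le fun i hi => absurd ⟨i, hi⟩ hc
    exact Submodule.finiteDimensional_of_le (hle.trans this)

end IsHighestWeight

end Graded

/-! ### Graded Verma modules and their quotients by the sum of all proper submodules -/

section GradedVerma

variable {L : Type*} [LieRing L] [LieAlgebra ℂ L] {d : L}

theorem iSupIndep_grade (d : L) : iSupIndep (grade d) :=
  (LieAlgebra.ad ℂ L d).eigenspaces_iSupIndep.comp Int.cast_injective

variable (d) in
/-- The subalgebra spanned by the homogeneous elements whose degree lies in an additively closed
set. -/
def gradeSubalgebra (p : ℤ → Prop) (hp : ∀ j k, p j → p k → p (j + k)) : LieSubalgebra ℂ L where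
  toSubmodule := ⨆ k, ⨆ _ : p k, grade d k
  lie_mem' := by
    intro x y hx hy
    have h : (⨆ k, ⨆ _ : p k, grade d k) ≤
        (⨆ k, ⨆ _ : p k, grade d k).comap ((LieAlgebra.ad ℂ L : L →ₗ[ℂ] Module.End ℂ L).flip y) := by
      refine iSup₂_le fun j hj x hx => ?_
      have h' : (⨆ k, ⨆ _ : p k, grade d k) ≤
          (⨆ k, ⨆ _ : p k, grade d k).comap (LieAlgebra.ad ℂ L x) :=
        iSup₂_le fun k hk y hy => Submodule.mem_iSup_of_mem (j + k)
          (Submodule.mem_iSup_of_mem (hp j k hj hk) (lie_mem_grade hx hy))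
      exact h' hy
    exact h hx

theorem isCompl_biSup_grade (hd : ⨆ k, grade d k = ⊤) (p : ℤ → Prop) :
    IsCompl (⨆ k, ⨆ _ : p k, grade d k) (⨆ k, ⨆ _ : ¬ p k, grade d k) := by
  refine ⟨(iSupIndep_grade d).disjoint_biSup_biSup (s := {k | p k}) (t := {k | ¬ p k}) ?_,
    codisjoint_iff.mpr (eq_top_iff.mpr ?_)⟩
  · exact Set.disjoint_left.mpr fun k hk hk' => hk' hk
  · rw [← hd, iSup_le_iff]
    intro k
    by_cases hk : p k
    · exact le_sup_of_le_left (le_iSup₂_of_le k hk le_rfl)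
    · exact le_sup_of_le_right (le_iSup₂_of_le k hk le_rfl)

variable {χ : L →ₗ[ℂ] ℂ}

/-- The projection of a Verma module onto its highest weight line, normalised at the generator. -/
theorem exists_functional_quotient (hd : ⨆ k, grade d k = ⊤)
    (hpos : ∀ k, 0 < k → ∀ x ∈ grade d k, χ x = 0)
    (hzero : ∀ x ∈ grade d 0, ∀ y ∈ grade d 0, χ ⁅x, y⁆ = 0)
    {T : Set (UniversalEnvelopingAlgebra ℂ L)}
    (hT : ∀ t ∈ T, ∃ x ∈ ⨆ k : ℤ, ⨆ _ : 0 ≤ k, grade d k,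
      t = UniversalEnvelopingAlgebra.ι ℂ x - algebraMap ℂ _ (χ x)) :
    ∃ ε : (UniversalEnvelopingAlgebra ℂ L ⧸
        Submodule.span (UniversalEnvelopingAlgebra ℂ L) T) →ₗ[ℂ] ℂ,
      ε (Submodule.Quotient.mk 1) = 1 ∧
        ∀ i, 0 < i → ∀ y ∈ grade d (-i), ∀ w, ε (lieAct _ y w) = 0 := by
  let n := gradeSubalgebra d (fun k => ¬ 0 ≤ k) (fun j k hj hk => by omega)
  let b := gradeSubalgebra d (fun k => 0 ≤ k) (fun j k hj hk => by omega)
  have hχ : ∀ x ∈ b, ∀ y ∈ b, χ ⁅x, y⁆ = 0 := by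
    intro x hx y hy
    have h : (⨆ k : ℤ, ⨆ _ : 0 ≤ k, grade d k) ≤
        LinearMap.ker (χ ∘ₗ (LieAlgebra.ad ℂ L : L →ₗ[ℂ] Module.End ℂ L).flip y) := by
      refine iSup₂_le fun j hj x hx => ?_
      have h' : (⨆ k : ℤ, ⨆ _ : 0 ≤ k, grade d k) ≤ LinearMap.ker (χ ∘ₗ LieAlgebra.ad ℂ L x) := by
        refine iSup₂_le fun k hk y hy => ?_
        change χ ⁅x, y⁆ = 0
        have hxy := lie_mem_grade hx hy
        -- Both degrees are nonnegative: either their sum is positive, where `χ` vanishes, or both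
        -- are zero.
        by_cases hjk : 0 < j + k
        · exact hpos _ hjk _ hxy
        · obtain rfl : j = 0 := by omega
          obtain rfl : k = 0 := by omega
          exact hzero x hx y hy
      exact h' hy
    exact h hx
  obtain ⟨ε, h1, hb, hn⟩ := exists_inducedFunctional n b (isCompl_biSup_grade hd _).symm χ hχ
  let J := Submodule.span (UniversalEnvelopingAlgebra ℂ L) T
  have hJ : J.restrictScalars ℂ ≤ LinearMap.ker ε := by
    intro u hu
    -- `ε` is only `ℂ`-linear; quantifying over all left multiples lets the claim pass through a
    -- left ideal span.
    have h : ∀ c : UniversalEnvelopingAlgebra ℂ L, ε (c * u) = 0 := by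
      replace hu : u ∈ Submodule.span (UniversalEnvelopingAlgebra ℂ L) T := hu
      induction hu using Submodule.span_induction with
      | mem t ht =>
        obtain ⟨x, hx, rfl⟩ := hT t ht
        intro c
        rw [mul_sub, map_sub, hb c x hx, ← Algebra.commutes, ← Algebra.smul_def, map_smul,
          smul_eq_mul, sub_self]
      | zero => intro c; rw [mul_zero, map_zero]
      | add a b _ _ ha hb => intro c; rw [mul_add, map_add, ha, hb, add_zero]
      | smul r a _ ha => intro c; rw [smul_eq_mul, ← mul_assoc]; exact ha _
    simpa using h 1
  refine ⟨(J.restrictScalars ℂ).liftQ ε hJ, h1, ?_⟩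
  intro i hi y hy w
  obtain ⟨w, rfl⟩ := Submodule.Quotient.mk_surjective _ w
  refine hn y ?_ w
  exact Submodule.mem_iSup_of_mem (-i) (Submodule.mem_iSup_of_mem (by omega) hy)

theorem isHighestWeight_quotient {J : Submodule (UniversalEnvelopingAlgebra ℂ L)
      (UniversalEnvelopingAlgebra ℂ L)}
    (hpos : ∀ k, 0 < k → ∀ x ∈ grade d k, UniversalEnvelopingAlgebra.ι ℂ x ∈ J)
    (hzero : ∀ x ∈ grade d 0, UniversalEnvelopingAlgebra.ι ℂ x - algebraMap ℂ _ (χ x) ∈ J) :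
    IsHighestWeight d χ (Submodule.Quotient.mk 1 : UniversalEnvelopingAlgebra ℂ L ⧸ J) where
  generates := by
    refine eq_top_iff.mpr fun w _ => ?_
    obtain ⟨w, rfl⟩ := Submodule.Quotient.mk_surjective _ w
    refine Submodule.mem_span_singleton.mpr ⟨w, ?_⟩
    rw [← Submodule.Quotient.mk_smul, smul_eq_mul, mul_one]
  pos k hk x hx := by
    rw [lieAct_apply, ← Submodule.Quotient.mk_smul, Submodule.Quotient.mk_eq_zero, smul_eq_mul,
      mul_one]
    exact hpos k hk x hx
  zero x hx := by
    rw [lieAct_apply, ← Submodule.Quotient.mk_smul, ← Submodule.Quotient.mk_smul,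
      Submodule.Quotient.eq, smul_eq_mul, mul_one, ← Algebra.algebraMap_eq_smul_one]
    exact hzero x hx

variable {V : Type*} [AddCommGroup V] [Module ℂ V] [Module (UniversalEnvelopingAlgebra ℂ L) V]
  [IsScalarTower ℂ (UniversalEnvelopingAlgebra ℂ L) V]

theorem IsHighestWeight.quotient {v : V} (h : IsHighestWeight d χ v)
    (N : Submodule (UniversalEnvelopingAlgebra ℂ L) V) :
    IsHighestWeight d χ (Submodule.Quotient.mk v : V ⧸ N) where
  generates := by
    have := Submodule.map_span N.mkQ {v}
    rw [h.generates, Submodule.map_top, Submodule.range_mkQ, Set.image_singleton] at this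
    exact this.symm
  pos k hk x hx := by
    rw [lieAct_apply, ← Submodule.Quotient.mk_smul, ← lieAct_apply, h.pos k hk x hx,
      Submodule.Quotient.mk_zero]
  zero x hx := by
    rw [lieAct_apply, ← Submodule.Quotient.mk_smul, ← lieAct_apply, h.zero x hx,
      Submodule.Quotient.mk_smul]

/-- `ε` kills each proper submodule, hence their sum, but not `v`. -/
theorem IsHighestWeight.mk_sSup_ne_zero {v : V} (h : IsHighestWeight d χ v)
    (hd : ⨆ k, grade d k = ⊤) {ε : V →ₗ[ℂ] ℂ} (hv : ε v = 1)
    (hneg : ∀ i, 0 < i → ∀ y ∈ grade d (-i), ∀ w, ε (lieAct V y w) = 0) :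
    (Submodule.Quotient.mk v : V ⧸ sSup {N : Submodule (UniversalEnvelopingAlgebra ℂ L) V | N ≠ ⊤})
      ≠ 0 := by
  rw [Ne, Submodule.Quotient.mk_eq_zero]
  intro hmem
  have key : ∀ w ∈ sSup {N : Submodule (UniversalEnvelopingAlgebra ℂ L) V | N ≠ ⊤}, ε w = 0 := by
    intro w hw
    rw [sSup_eq_iSup'] at hw
    induction hw using Submodule.iSup_induction' with
    | mem N w hw => exact h.apply_eq_zero_of_mem_of_ne_top hd hv hneg N.2 hw
    | zero => exact map_zero _
    | add a b _ _ ha hb => rw [map_add, ha, hb, add_zero]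
  exact one_ne_zero (hv.symm.trans (key v hmem))

/-- A proper submodule of the quotient pulls back to a proper submodule of `M`, which the sum
already contains. The quotient may be zero here; for `V(ψ)` this is excluded by
`highestWeightVector_ne_zero`. -/
theorem eq_bot_of_ne_top_quotient_sSup {R M : Type*} [Ring R] [AddCommGroup M] [Module R M]
    (N : Submodule R (M ⧸ sSup {N : Submodule R M | N ≠ ⊤})) (hN : N ≠ ⊤) : N = ⊥ := by
  let N' : Submodule R M := N.comap (Submodule.mkQ _)
  have h : N' ≠ ⊤ := fun h => hN <| by
    rw [eq_top_iff]
    intro w _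
    obtain ⟨w, rfl⟩ := Submodule.Quotient.mk_surjective _ w
    have : w ∈ N' := h ▸ Submodule.mem_top
    exact this
  have hle := le_sSup (a := N') (s := {N : Submodule R M | N ≠ ⊤}) h
  rw [eq_bot_iff]
  intro w hw
  obtain ⟨w, rfl⟩ := Submodule.Quotient.mk_surjective _ w
  exact (Submodule.Quotient.mk_eq_zero _).mpr (hle hw)

end GradedVerma

/-! ### The grading of `τ` by `N L₀ + ρ` -/

section TauGrading

set_option linter.unusedSectionVars false

open LieAlgebra LieAlgebra.IsKilling LieModule

theorem iSup_rootSpace {𝔤 : Type*} [LieRing 𝔤] [LieAlgebra ℂ 𝔤] [FiniteDimensional ℂ 𝔤]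
    {H : LieSubalgebra ℂ 𝔤} [H.IsCartanSubalgebra] :
    ⨆ α : Weight ℂ H 𝔤, (rootSpace H α).toSubmodule = ⊤ := by
  have := iSup_genWeightSpace_eq_top' ℂ H 𝔤
  rw [← LieSubmodule.toSubmodule_inj, LieSubmodule.iSup_toSubmodule] at this
  exact this

/-- The element `N L₀ + ρ` of `𝔥̄`, whose adjoint eigenvalues grade `τ`. -/
def gradingElement {𝔤 : Type*} [LieRing 𝔤] [LieAlgebra ℂ 𝔤] (κ : InvariantForm 𝔤)
    {H : LieSubalgebra ℂ 𝔤} (N : ℤ) (ρ : H) : Tau κ := (N : ℂ) • Tau.L κ 0 + Tau.X κ 0 (ρ : 𝔤)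

theorem gradingElement_mem_hbar {𝔤 : Type*} [LieRing 𝔤] [LieAlgebra ℂ 𝔤]
    (κ : InvariantForm 𝔤) {H : LieSubalgebra ℂ 𝔤} (N : ℤ) (ρ : H) : gradingElement κ N ρ ∈ hbar κ H :=
  add_mem (Submodule.smul_mem _ _ (Submodule.mem_sup_right (Submodule.subset_span (by simp))))
    (Submodule.mem_sup_left (Submodule.mem_map_of_mem ρ.2))

variable {𝔤 : Type*} [LieRing 𝔤] [LieAlgebra ℂ 𝔤] [FiniteDimensional ℂ 𝔤] [LieAlgebra.IsSimple ℂ 𝔤]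
  {H : LieSubalgebra ℂ 𝔤} [H.IsCartanSubalgebra]

theorem nontrivial_of_isSimple (𝔤 : Type*) [LieRing 𝔤] [LieAlgebra ℂ 𝔤] [LieAlgebra.IsSimple ℂ 𝔤] :
    Nontrivial 𝔤 := by
  by_contra h
  rw [not_nontrivial_iff_subsingleton] at h
  exact LieAlgebra.IsSimple.non_abelian (R := ℂ) (L := 𝔤) ⟨fun x y => Subsingleton.elim _ _⟩

open Classical in
/-- The height of a weight of the adjoint representation; it is `0` for the zero weight. -/
def weightHeight (b : (rootSystem H).Base) (α : Weight ℂ H 𝔤) : ℤ :=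
  if hα : α ∈ H.root then b.height ⟨α, hα⟩ else 0

theorem weightHeight_coe_root (b : (rootSystem H).Base) (α : H.root) :
    weightHeight b α = b.height α := dif_pos α.2

theorem weightHeight_eq_zero_iff (b : (rootSystem H).Base) (α : Weight ℂ H 𝔤) :
    weightHeight b α = 0 ↔ α.IsZero := by
  by_cases hα : α ∈ H.root
  · rw [weightHeight, dif_pos hα]
    exact iff_of_false (b.height_ne_zero _) (LieSubalgebra.isNonZero_coe_root ⟨α, hα⟩)
  · rw [weightHeight, dif_neg hα]
    simpa using hα

/-- The functional on `𝔥*` that is `1` on every simple root is evaluation at some `ρ ∈ 𝔥`; on any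
root it returns the sum of the simple-root coefficients. -/
theorem exists_apply_eq_weightHeight (b : (rootSystem H).Base) :
    ∃ ρ : H, ∀ α : Weight ℂ H 𝔤, α ρ = weightHeight b α := by
  let f : Module.Dual ℂ H →ₗ[ℂ] ℂ := b.toWeightBasis.constr ℂ (fun _ => (1 : ℂ))
  have hf : ∀ j ∈ b.support, f ((rootSystem H).root j) = 1 := by
    intro j hj
    have := b.toWeightBasis.constr_basis ℂ (fun _ => (1 : ℂ)) ⟨j, hj⟩
    rwa [b.toWeightBasis_apply] at this
  refine ⟨(Module.evalEquiv ℂ H).symm f, fun α => ?_⟩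
  have h : ∀ φ : Module.Dual ℂ H, φ ((Module.evalEquiv ℂ H).symm f) = f φ := fun φ => by
    have := (Module.evalEquiv ℂ H).apply_symm_apply f
    exact DFunLike.congr_fun this φ
  by_cases hα : α ∈ H.root
  · obtain ⟨g, -, -, hg⟩ := b.exists_root_eq_sum_int ⟨α, hα⟩
    rw [weightHeight, dif_pos hα, RootPairing.Base.height_eq_sum hg]
    have h1 := h ((rootSystem H).root ⟨α, hα⟩)
    rw [hg, map_sum, ← hg] at h1
    rw [rootSystem_root_apply] at h1
    refine h1.trans ?_
    push_cast
    refine Finset.sum_congr rfl fun j hj => ?_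
    rw [map_zsmul, hf j hj, zsmul_eq_mul, mul_one]
  · have hz : α.IsZero := by simpa using hα
    rw [weightHeight, dif_neg hα, hz, Pi.zero_apply, Int.cast_zero]

/-- With this `N` the power of `t` dominates: `N * n + ht α` has the sign of `n` unless `n = 0`. -/
theorem exists_abs_weightHeight_lt (b : (rootSystem H).Base) :
    ∃ N : ℤ, ∀ α : Weight ℂ H 𝔤, |weightHeight b α| < N := by
  obtain ⟨N, hN⟩ := (Set.finite_range fun α : Weight ℂ H 𝔤 => |weightHeight b α|).bddAbove
  exact ⟨N + 1, fun α => Int.lt_add_one_of_le (hN ⟨α, rfl⟩)⟩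

variable (κ : InvariantForm 𝔤)

/-- The homogeneous blocks of `τ`: the spaces `𝔤_α ⊗ t^n`, the lines `ℂ L_n` and the line `ℂ K`. -/
def tauBlock : (ℤ × Weight ℂ H 𝔤) ⊕ ℤ ⊕ Unit → Submodule ℂ (Tau κ)
  | .inl (n, α) => (rootSpace H α).toSubmodule.map (Tau.X κ n)
  | .inr (.inl n) => Submodule.span ℂ {Tau.L κ n}
  | .inr (.inr _) => Submodule.span ℂ {Tau.K κ}

/-- The degrees of the homogeneous blocks of `τ`. -/
def tauDegree (b : (rootSystem H).Base) (N : ℤ) : (ℤ × Weight ℂ H 𝔤) ⊕ ℤ ⊕ Unit → ℤ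
  | .inl (n, α) => N * n + weightHeight b α
  | .inr (.inl n) => N * n
  | .inr (.inr _) => 0

theorem range_X_le {n : ℤ} {W : Submodule ℂ (Tau κ)}
    (h : ∀ α : Weight ℂ H 𝔤, tauBlock κ (.inl (n, α)) ≤ W) : LinearMap.range (Tau.X κ n) ≤ W := by
  rw [LinearMap.range_eq_map, ← iSup_rootSpace (H := H), Submodule.map_iSup]
  exact iSup_le h

theorem iSup_tauBlock : ⨆ i, tauBlock (H := H) κ i = ⊤ := by
  refine Submodule.eq_top_iff'.mpr fun x => ?_
  induction x using Tau.induction with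
  | hX n x =>
    exact range_X_le κ (fun α => le_iSup (tauBlock (H := H) κ) (.inl (n, α))) ⟨x, rfl⟩
  | hL n =>
    exact Submodule.mem_iSup_of_mem (.inr (.inl n)) (Submodule.mem_span_singleton_self _)
  | hK => exact Submodule.mem_iSup_of_mem (.inr (.inr ())) (Submodule.mem_span_singleton_self _)
  | hadd x y hx hy => exact add_mem hx hy
  | hsmul c x hx => exact Submodule.smul_mem _ c hx

variable {κ} {N : ℤ} {ρ : H} {b : (rootSystem H).Base}

/-- On `𝔤_α ⊗ t^n`, `N L₀` contributes `N * n` and `ρ` the height of `α`. The central term of `[ρ, x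
⊗ t^n]` vanishes, being `n` times a delta that requires `n = 0`. -/
theorem tauBlock_le_grade (hρ : ∀ α : Weight ℂ H 𝔤, α ρ = weightHeight b α)
    (i : (ℤ × Weight ℂ H 𝔤) ⊕ ℤ ⊕ Unit) :
    tauBlock κ i ≤ grade (gradingElement κ N ρ) (tauDegree b N i) := by
  obtain ⟨n, α⟩ | n | _ := i
  · rintro _ ⟨x, hx, rfl⟩
    have h := lie_eq_smul_of_mem_rootSpace hx ρ
    rw [hρ] at h
    rw [mem_grade, gradingElement, add_lie, smul_lie, Tau.L_bracket_X, Tau.X_bracket_X,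
      show ⁅(ρ : 𝔤), x⁆ = ⁅ρ, x⁆ from rfl, h, map_smul]
    rw [add_zero, tauDegree]
    by_cases hn : n = 0
    · simp [hn]
    · simp [hn, add_smul, mul_smul]
  · refine (Submodule.span_singleton_le_iff_mem _ _).mpr ?_
    rw [mem_grade, gradingElement, add_lie, smul_lie, Tau.L_bracket_L, Tau.X_bracket_L, tauDegree]
    simp [mul_smul]
  · refine (Submodule.span_singleton_le_iff_mem _ _).mpr ?_
    rw [mem_grade, Tau.bracket_K, tauDegree]
    simp

theorem pos_of_abs_weightHeight_lt (hN : ∀ α : Weight ℂ H 𝔤, |weightHeight b α| < N) : 0 < N := by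
  have := nontrivial_of_isSimple 𝔤
  exact (abs_nonneg _).trans_lt (hN 0)

/-- Degree zero forces `n = 0`, since heights are smaller than `N`, and then height zero, which
leaves only the zero root space `𝔥`. -/
theorem tauBlock_le_hbar (hN : ∀ α : Weight ℂ H 𝔤, |weightHeight b α| < N)
    {i : (ℤ × Weight ℂ H 𝔤) ⊕ ℤ ⊕ Unit} (hi : tauDegree b N i = 0) :
    tauBlock κ i ≤ hbar κ H := by
  have hN0 : 0 < N := pos_of_abs_weightHeight_lt hN
  obtain ⟨n, α⟩ | n | _ := i
  · rw [tauDegree] at hi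
    have h := abs_lt.mp (hN α)
    have hn : n = 0 := by
      by_contra hn
      rcases lt_or_gt_of_ne hn with hn | hn
      · nlinarith
      · nlinarith
    subst hn
    rw [mul_zero, zero_add, weightHeight_eq_zero_iff] at hi
    refine le_sup_of_le_left (Submodule.map_mono ?_)
    have : rootSpace H α = rootSpace H 0 := congrArg (rootSpace H) hi
    rw [this, rootSpace_zero_eq]
    exact le_rfl
  · rw [tauDegree, mul_eq_zero] at hi
    obtain rfl := hi.resolve_left hN0.ne'
    exact le_sup_of_le_right (Submodule.span_mono (by simp))
  · exact le_sup_of_le_right (Submodule.span_mono (by simp))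

theorem tauBlock_le_tauPos (hN : ∀ α : Weight ℂ H 𝔤, |weightHeight b α| < N)
    {i : (ℤ × Weight ℂ H 𝔤) ⊕ ℤ ⊕ Unit} (hi : 0 < tauDegree b N i) :
    tauBlock κ i ≤ tauPos κ H b := by
  have hN0 : 0 < N := pos_of_abs_weightHeight_lt hN
  obtain ⟨n, α⟩ | n | _ := i
  · rw [tauDegree] at hi
    have h := abs_lt.mp (hN α)
    rcases lt_trichotomy n 0 with hn | rfl | hn
    · nlinarith
    · rw [mul_zero, zero_add] at hi
      refine le_sup_of_le_left (le_sup_of_le_left (Submodule.map_mono ?_))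
      have hα : α ∈ H.root := by
        by_contra hα
        rw [weightHeight, dif_neg hα] at hi
        exact lt_irrefl _ hi
      rw [weightHeight, dif_pos hα] at hi
      exact le_iSup₂_of_le (⟨α, hα⟩ : H.root) hi le_rfl
    · refine le_sup_of_le_left (le_sup_of_le_right (le_iSup₂_of_le n hn ?_))
      exact LinearMap.map_le_range
  · rw [tauDegree] at hi
    exact le_sup_of_le_right (Submodule.span_mono
      (by simpa using ⟨n, (mul_pos_iff_of_pos_left hN0).mp hi, rfl⟩))
  · exact absurd hi (lt_irrefl _)

theorem tauPos_le_biSup_grade (hN : ∀ α : Weight ℂ H 𝔤, |weightHeight b α| < N)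
    (hρ : ∀ α : Weight ℂ H 𝔤, α ρ = weightHeight b α) :
    tauPos κ H b ≤ ⨆ k : ℤ, ⨆ _ : 0 < k, grade (gradingElement κ N ρ) k := by
  have hN0 : 0 < N := pos_of_abs_weightHeight_lt hN
  have key : ∀ i, 0 < tauDegree b N i →
      tauBlock κ i ≤ ⨆ k : ℤ, ⨆ _ : 0 < k, grade (gradingElement κ N ρ) k :=
    fun i hi => (tauBlock_le_grade hρ i).trans (le_iSup₂_of_le _ hi le_rfl)
  refine sup_le (sup_le ?_ ?_) ?_
  · rw [nPos, Submodule.map_iSup]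
    refine iSup_le fun α => ?_
    rw [Submodule.map_iSup]
    refine iSup_le fun hα => key (.inl (0, α)) ?_
    rw [tauDegree, mul_zero, zero_add, weightHeight_coe_root]
    exact hα
  · refine iSup₂_le fun n hn => range_X_le κ fun α => key _ ?_
    have h := abs_lt.mp (hN α)
    rw [tauDegree]
    nlinarith
  · refine Submodule.span_le.mpr ?_
    rintro _ ⟨n, hn, rfl⟩
    exact key (.inr (.inl n)) (mul_pos hN0 hn) (Submodule.mem_span_singleton_self _)

theorem hbar_le_grade (hρ : ∀ α : Weight ℂ H 𝔤, α ρ = weightHeight b α) :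
    hbar κ H ≤ grade (gradingElement κ N ρ) 0 := by
  have := nontrivial_of_isSimple 𝔤
  refine sup_le ?_ (Submodule.span_le.mpr ?_)
  · have h := tauBlock_le_grade (κ := κ) (N := N) hρ (.inl (0, 0))
    rw [tauDegree, mul_zero, zero_add, (weightHeight_eq_zero_iff b 0).mpr Weight.isZero_zero] at h
    refine le_trans (Submodule.map_mono ?_) h
    rw [FunLike.coe_zero, rootSpace_zero_eq]
    exact le_rfl
  · rintro _ (rfl | rfl)
    · exact tauBlock_le_grade (b := b) hρ (.inr (.inr ())) (Submodule.mem_span_singleton_self _)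
    · have h := tauBlock_le_grade (κ := κ) (N := N) (b := b) hρ (.inr (.inl 0))
        (Submodule.mem_span_singleton_self _)
      rwa [tauDegree, mul_zero] at h

/-- A fixed degree bounds `n` because heights are smaller than `N`, and there are finitely many
weights. -/
theorem finite_tauDegree_eq (hN : ∀ α : Weight ℂ H 𝔤, |weightHeight b α| < N) (k : ℤ) :
    {i | tauDegree b N i = k}.Finite := by
  have hN0 : 0 < N := pos_of_abs_weightHeight_lt hN
  have hI : (Set.Icc (-|k| - 1) (|k| + 1)).Finite := Set.finite_Icc _ _
  refine (((hI.prod (Set.finite_univ (α := Weight ℂ H 𝔤))).image Sum.inl).union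
    ((hI.image (Sum.inr ∘ Sum.inl)).union (Set.finite_singleton (.inr (.inr ()))))).subset ?_
  have bound : ∀ n h : ℤ, |h| < N → N * n + h = k → -|k| - 1 ≤ n ∧ n ≤ |k| + 1 := by
    intro n h hh e
    have h1 := abs_lt.mp hh
    have h2 := le_abs_self k
    have h3 := neg_abs_le k
    have h4 := abs_nonneg k
    constructor
    · by_contra! hn
      nlinarith
    · by_contra! hn
      nlinarith
  rintro (⟨n, α⟩ | n | u) hi
  · refine Or.inl ⟨(n, α), ⟨?_, Set.mem_univ _⟩, rfl⟩
    exact bound n _ (hN α) hi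
  · refine Or.inr (Or.inl ⟨n, ?_, rfl⟩)
    exact bound n 0 (by simpa using hN0) (by simpa [tauDegree] using hi)
  · exact Or.inr (Or.inr rfl)

theorem fg_tauBlock (i : (ℤ × Weight ℂ H 𝔤) ⊕ ℤ ⊕ Unit) : (tauBlock κ i).FG := by
  obtain ⟨n, α⟩ | n | _ := i
  · exact (IsNoetherian.noetherian (rootSpace H α).toSubmodule).map (Tau.X κ n)
  · exact Submodule.fg_span_singleton _
  · exact Submodule.fg_span_singleton _

theorem fg_biSup_tauBlock (hN : ∀ α : Weight ℂ H 𝔤, |weightHeight b α| < N) (k : ℤ) :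
    (⨆ i, ⨆ _ : tauDegree b N i = k, tauBlock κ i).FG := by
  have h := Submodule.fg_biSup (finite_tauDegree_eq hN k).toFinset (tauBlock κ)
    fun i _ => fg_tauBlock i
  simpa only [Set.Finite.mem_toFinset, Set.mem_ofPred_eq] using h

theorem exists_eq_of_mem_hbar {y : Tau κ} (hy : y ∈ hbar κ H) :
    ∃ h : H, ∃ c e : ℂ, y = Tau.X κ 0 (h : 𝔤) + (c • Tau.K κ + e • Tau.L κ 0) := by
  obtain ⟨_, ⟨h, hh, rfl⟩, z, hz, rfl⟩ := Submodule.mem_sup.mp hy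
  obtain ⟨c, e, rfl⟩ := Submodule.mem_span_pair.mp hz
  exact ⟨⟨h, hh⟩, c, e, rfl⟩

theorem lie_eq_zero_of_mem_hbar {x y : Tau κ} (hx : x ∈ hbar κ H) (hy : y ∈ hbar κ H) :
    ⁅x, y⁆ = 0 := by
  obtain ⟨h, c, e, rfl⟩ := exists_eq_of_mem_hbar hx
  obtain ⟨h', c', e', rfl⟩ := exists_eq_of_mem_hbar hy
  have hhh : ⁅(h : 𝔤), (h' : 𝔤)⁆ = 0 := congrArg Subtype.val (trivial_lie_zero H H h h')
  simp [Tau.X_bracket_X, Tau.X_bracket_L, Tau.L_bracket_X, Tau.K_bracket, Tau.bracket_K, hhh]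

theorem fg_hbar : (hbar κ H).FG :=
  Submodule.FG.sup ((IsNoetherian.noetherian H.toSubmodule).map _)
    (Submodule.fg_span (Set.toFinite _))

end TauGrading

/-! ### The grading of `τ(A)`, and `V(ψ)` as a graded highest weight module -/

section LoopGrading

open LieAlgebra LieAlgebra.IsKilling LieModule

variable (A : Type*) [CommRing A] [Algebra ℂ A]

section Current

variable {L : Type*} [LieRing L] [LieAlgebra ℂ L]

/-- The subspace `W(A) = W ⊗ A` of the current algebra `L(A) = L ⊗ A`. -/
def current (W : Submodule ℂ L) : Submodule ℂ (A ⊗[ℂ] L) :=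
  Submodule.map₂ (TensorProduct.mk ℂ A L) ⊤ W

variable {A}

theorem tmul_mem_current {W : Submodule ℂ L} (a : A) {x : L} (hx : x ∈ W) :
    a ⊗ₜ[ℂ] x ∈ current A W :=
  Submodule.apply_mem_map₂ (TensorProduct.mk ℂ A L) (Submodule.mem_top (x := a)) hx

theorem current_le {W : Submodule ℂ L} {Q : Submodule ℂ (A ⊗[ℂ] L)} :
    current A W ≤ Q ↔ ∀ (a : A), ∀ x ∈ W, a ⊗ₜ[ℂ] x ∈ Q := by
  rw [current, Submodule.map₂_le]
  exact ⟨fun h a x hx => h a Submodule.mem_top x hx, fun h a _ x hx => h a x hx⟩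

theorem tmul_mem_grade {d : L} {k : ℤ} (a : A) {x : L} (hx : x ∈ grade d k) :
    a ⊗ₜ[ℂ] x ∈ grade ((1 : A) ⊗ₜ[ℂ] d) k := by
  rw [mem_grade] at *
  rw [LieAlgebra.ExtendScalars.bracket_tmul, one_mul, hx, TensorProduct.tmul_smul]

theorem current_grade_le (d : L) (k : ℤ) :
    current A (grade d k) ≤ grade ((1 : A) ⊗ₜ[ℂ] d) k :=
  current_le.mpr fun a _ hx => tmul_mem_grade a hx

theorem iSup_current_eq_top {ι : Type*} {E : ι → Submodule ℂ L} (hE : ⨆ i, E i = ⊤) :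
    ⨆ i, current A (E i) = ⊤ := by
  simp only [current]
  rw [← Submodule.map₂_iSup_right, hE, TensorProduct.map₂_mk_top_top_eq_top]

/-- The spaces `E i ⊗ A` consist of eigenvectors and span, so each eigenspace is the sum of those
with its eigenvalue. -/
theorem grade_le_current {ι : Type*} {E : ι → Submodule ℂ L} {d : L} {deg : ι → ℤ}
    (hE : ⨆ i, E i = ⊤) (hdeg : ∀ i, E i ≤ grade d (deg i)) (k : ℤ) :
    grade ((1 : A) ⊗ₜ[ℂ] d) k ≤ current A (⨆ i, ⨆ _ : deg i = k, E i) := by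
  have h := eigenspace_le_iSup_of_iSup_eq_top (LieAlgebra.ad ℂ (A ⊗[ℂ] L) ((1 : A) ⊗ₜ[ℂ] d))
    (fun i => current A (E i)) (fun i => (deg i : ℂ))
    (fun i => current_le.mpr fun a x hx => tmul_mem_grade a (hdeg i hx))
    (iSup_current_eq_top hE) k
  refine h.trans (iSup₂_le fun i hi => ?_)
  exact Submodule.map₂_le_map₂_right (le_iSup₂_of_le i (Int.cast_injective hi) le_rfl)

theorem iSup_grade_eq_top {ι : Type*} {E : ι → Submodule ℂ L} {d : L} {deg : ι → ℤ}
    (hE : ⨆ i, E i = ⊤) (hdeg : ∀ i, E i ≤ grade d (deg i)) :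
    ⨆ k, grade ((1 : A) ⊗ₜ[ℂ] d) k = ⊤ := by
  rw [eq_top_iff, ← iSup_current_eq_top (A := A) hE, iSup_le_iff]
  exact fun i => (current_le.mpr fun a x hx => tmul_mem_grade a (hdeg i hx)).trans
    (le_iSup (grade ((1 : A) ⊗ₜ[ℂ] d)) (deg i))

/-- The ideal `L(I) = L ⊗ I` of the current algebra `L(A)`. -/
def currentIdeal (L : Type*) [LieRing L] [LieAlgebra ℂ L] (I : Ideal A) :
    LieIdeal ℂ (A ⊗[ℂ] L) where
  toSubmodule := Submodule.map₂ (TensorProduct.mk ℂ A L) (I.restrictScalars ℂ) ⊤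
  lie_mem := by
    intro x m hm
    have key : ∀ (a : A) (y : L), Submodule.map₂ (TensorProduct.mk ℂ A L) (I.restrictScalars ℂ) ⊤ ≤
        (Submodule.map₂ (TensorProduct.mk ℂ A L) (I.restrictScalars ℂ) ⊤).comap
          (LieAlgebra.ad ℂ (A ⊗[ℂ] L) (a ⊗ₜ[ℂ] y)) := by
      intro a y
      refine Submodule.map₂_le.mpr fun c hc z _ => ?_
      rw [Submodule.mem_comap, LieAlgebra.ad_apply, TensorProduct.mk_apply,
        LieAlgebra.ExtendScalars.bracket_tmul]
      exact Submodule.apply_mem_map₂ (TensorProduct.mk ℂ A L) (I.mul_mem_left a hc)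
        Submodule.mem_top
    induction x using TensorProduct.induction_on with
    | zero => rw [zero_lie]; exact Submodule.zero_mem _
    | tmul a y => exact key a y hm
    | add x y hx hy => rw [add_lie]; exact Submodule.add_mem _ hx hy

theorem tmul_mem_currentIdeal {I : Ideal A} {a : A} (ha : a ∈ I) (x : L) :
    a ⊗ₜ[ℂ] x ∈ currentIdeal L I :=
  Submodule.apply_mem_map₂ (TensorProduct.mk ℂ A L) (show a ∈ I.restrictScalars ℂ from ha)
    (Submodule.mem_top (x := x))

theorem currentIdeal_le {I : Ideal A} {Q : Submodule ℂ (A ⊗[ℂ] L)}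
    (h : ∀ a ∈ I, ∀ x : L, a ⊗ₜ[ℂ] x ∈ Q) : (currentIdeal L I).toSubmodule ≤ Q :=
  Submodule.map₂_le.mpr fun a ha x _ => h a ha x

theorem currentIdeal_le_iSup_inf_grade (I : Ideal A) {ι : Type*} {E : ι → Submodule ℂ L} {d : L}
    {deg : ι → ℤ} (hE : ⨆ i, E i = ⊤) (hdeg : ∀ i, E i ≤ grade d (deg i)) :
    (currentIdeal L I).toSubmodule ≤
      ⨆ k, (currentIdeal L I).toSubmodule ⊓ grade ((1 : A) ⊗ₜ[ℂ] d) k := by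
  refine currentIdeal_le fun a ha x => ?_
  have hx : x ∈ ⨆ i, E i := hE ▸ Submodule.mem_top
  induction hx using Submodule.iSup_induction' with
  | mem i x hx =>
    exact Submodule.mem_iSup_of_mem (deg i) ⟨tmul_mem_currentIdeal ha x, tmul_mem_grade a (hdeg i hx)⟩
  | zero => rw [TensorProduct.tmul_zero]; exact zero_mem _
  | add x y _ _ hx hy => rw [TensorProduct.tmul_add]; exact add_mem hx hy

/-- If `L(I)` acts trivially for a co-finite ideal `I`, then `W(A)` acts through a
finite-dimensional space for all finite-dimensional `W`. -/
theorem fg_map_lieAct_current {V : Type*} [AddCommGroup V] [Module ℂ V]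
    [Module (UniversalEnvelopingAlgebra ℂ (A ⊗[ℂ] L)) V]
    [IsScalarTower ℂ (UniversalEnvelopingAlgebra ℂ (A ⊗[ℂ] L)) V] (I : Ideal A)
    [FiniteDimensional ℂ (A ⧸ I)] (hI : ∀ a ∈ I, ∀ x : L, lieAct V (a ⊗ₜ[ℂ] x) = 0)
    {W : Submodule ℂ L} (hW : W.FG) : ((current A W).map (lieAct V)).FG := by
  -- A linear complement of `I` is finite-dimensional and carries the whole action of `A`, since the
  -- `I`-part acts by zero.
  obtain ⟨C, hC⟩ := Submodule.exists_isCompl (I.restrictScalars ℂ)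
  have hCfg : C.FG := by
    have e := Submodule.quotientEquivOfIsCompl _ _ hC
    have : FiniteDimensional ℂ (A ⧸ I.restrictScalars ℂ) := ‹FiniteDimensional ℂ (A ⧸ I)›
    exact (Submodule.fg_iff_finiteDimensional _).mpr (e.finiteDimensional)
  have heq : (current A W).map (lieAct V) =
      (Submodule.map₂ (TensorProduct.mk ℂ A L) C W).map (lieAct V) := by
    have h0 : (Submodule.map₂ (TensorProduct.mk ℂ A L) (I.restrictScalars ℂ) W).map (lieAct V) = ⊥ := by
      rw [eq_bot_iff, Submodule.map_le_iff_le_comap]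
      exact Submodule.map₂_le.mpr fun a ha x _ => hI a ha x
    rw [current, ← hC.sup_eq_top, Submodule.map₂_sup_left, Submodule.map_sup, h0, bot_sup_eq]
  rw [heq]
  exact (hCfg.map₂ _ hW).map _

end Current

variable {𝔤 : Type*} [LieRing 𝔤] [LieAlgebra ℂ 𝔤] [FiniteDimensional ℂ 𝔤] [LieAlgebra.IsSimple ℂ 𝔤]
  (κ : InvariantForm 𝔤) {H : LieSubalgebra ℂ 𝔤} [H.IsCartanSubalgebra]

/-- There is an element of `𝔥̄` whose adjoint eigenvalues are integers and give the triangular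
decomposition of `τ(A)`. -/
theorem exists_triangular_grading (b : (rootSystem H).Base) :
    ∃ d ∈ hbar κ H,
      (⨆ k, grade ((1 : A) ⊗ₜ[ℂ] d) k = ⊤) ∧
      (grade ((1 : A) ⊗ₜ[ℂ] d) 0 = current A (hbar κ H)) ∧
      (∀ k, 0 < k → grade ((1 : A) ⊗ₜ[ℂ] d) k ≤ current A (tauPos κ H b)) ∧
      (current A (tauPos κ H b) ≤ ⨆ k : ℤ, ⨆ _ : 0 < k, grade ((1 : A) ⊗ₜ[ℂ] d) k) ∧
      (∀ k, ∃ W : Submodule ℂ (Tau κ), W.FG ∧ grade ((1 : A) ⊗ₜ[ℂ] d) k ≤ current A W) ∧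
      (∀ I : Ideal A, (currentIdeal (Tau κ) I).toSubmodule ≤
        ⨆ k, (currentIdeal (Tau κ) I).toSubmodule ⊓ grade ((1 : A) ⊗ₜ[ℂ] d) k) ∧
      ∃ π : Tau κ →ₗ[ℂ] hbar κ H, (∀ h : hbar κ H, π h = h) ∧ ∀ x ∈ tauPos κ H b, π x = 0 := by
  obtain ⟨ρ, hρ⟩ := exists_apply_eq_weightHeight b
  obtain ⟨N, hN⟩ := exists_abs_weightHeight_lt b
  have htop : ⨆ i, tauBlock (H := H) κ i = ⊤ := iSup_tauBlock κ
  have hdeg := tauBlock_le_grade (κ := κ) (N := N) hρ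
  have hle := grade_le_current (A := A) htop hdeg
  refine ⟨gradingElement κ N ρ, gradingElement_mem_hbar κ N ρ, iSup_grade_eq_top htop hdeg,
    le_antisymm ?_ ?_, fun k hk => ?_, ?_, fun k => ?_, fun I => ?_, ?_⟩
  · exact (hle 0).trans (Submodule.map₂_le_map₂_right (iSup₂_le fun i hi => tauBlock_le_hbar hN hi))
  · exact (Submodule.map₂_le_map₂_right (hbar_le_grade hρ)).trans (current_grade_le _ 0)
  · exact (hle k).trans (Submodule.map₂_le_map₂_right
      (iSup₂_le fun i hi => tauBlock_le_tauPos hN (hi ▸ hk)))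
  · refine (Submodule.map₂_le_map₂_right (tauPos_le_biSup_grade hN hρ)).trans ?_
    simp only [Submodule.map₂_iSup_right]
    exact iSup₂_mono fun k _ => current_grade_le _ k
  · exact ⟨_, fg_biSup_tauBlock hN k, hle k⟩
  · exact currentIdeal_le_iSup_inf_grade I htop hdeg
  · have hd : ⨆ k, grade (gradingElement κ N ρ) k = ⊤ := by
      rw [eq_top_iff, ← htop]
      exact iSup_le fun i => (hdeg i).trans (le_iSup (grade (gradingElement κ N ρ)) _)
    have hc := isCompl_biSup_grade hd (fun k => ¬ 0 < k)
    have hc' : Disjoint (hbar κ H) (⨆ k : ℤ, ⨆ _ : 0 < k, grade (gradingElement κ N ρ) k) := by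
      simp only [not_not] at hc
      exact hc.disjoint.mono_left ((hbar_le_grade hρ).trans (le_iSup₂_of_le 0 (lt_irrefl _) le_rfl))
    -- The kernel of `π` has to contain `τ⁺`, so the complement of `𝔥̄` is chosen around the
    -- positive part.
    obtain ⟨Q, hQ, hQc⟩ := hc'.symm.exists_isCompl
    refine ⟨(hbar κ H).projectionOnto Q hQc.symm,
      fun h => Submodule.projectionOnto_apply_left _ h, fun x hx => ?_⟩
    exact Submodule.projectionOnto_apply_of_mem_right _ (hQ (tauPos_le_biSup_grade hN hρ hx))

variable {A κ} {b : (rootSystem H).Base}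

/-- The image of `1` in `V(ψ)`. -/
def highestWeightVector (b : (rootSystem H).Base) (ψ : A ⊗[ℂ] hbar κ H →ₗ[ℂ] ℂ) : IrrHW b ψ :=
  Submodule.Quotient.mk (Submodule.Quotient.mk 1)

variable {ψ : A ⊗[ℂ] hbar κ H →ₗ[ℂ] ℂ}

theorem elt_smul_eq_lieAct (a : A) (x : Tau κ) (w : IrrHW b ψ) :
    elt κ a x • w = lieAct (IrrHW b ψ) (a ⊗ₜ[ℂ] x) w := rfl

theorem eq_bot_of_ne_top_irrHW (N : Submodule (Env κ A) (IrrHW b ψ)) (hN : N ≠ ⊤) : N = ⊥ :=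
  eq_bot_of_ne_top_quotient_sSup N hN

section

variable {d : Tau κ} {π : Tau κ →ₗ[ℂ] hbar κ H}

attribute [local instance 100] LieRing.ofAssociativeRing in
theorem isHighestWeight_verma (h0 : grade ((1 : A) ⊗ₜ[ℂ] d) 0 = current A (hbar κ H))
    (hpos : ∀ k, 0 < k → grade ((1 : A) ⊗ₜ[ℂ] d) k ≤ current A (tauPos κ H b))
    (hπ : ∀ h : hbar κ H, π h = h) :
    IsHighestWeight ((1 : A) ⊗ₜ[ℂ] d) (ψ ∘ₗ π.lTensor A)
      (Submodule.Quotient.mk 1 : Verma b ψ) := by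
  refine isHighestWeight_quotient (fun k hk x hx => ?_) (fun x hx => ?_)
  · have : current A (tauPos κ H b) ≤ ((vermaIdeal b ψ).restrictScalars ℂ).comap
        (UniversalEnvelopingAlgebra.ι ℂ : A ⊗[ℂ] Tau κ →ₗ⁅ℂ⁆ Env κ A).toLinearMap :=
      current_le.mpr fun a x hx => Submodule.subset_span (Or.inl ⟨a, x, hx, rfl⟩)
    exact this (hpos k hk hx)
  · have : current A (hbar κ H) ≤ ((vermaIdeal b ψ).restrictScalars ℂ).comap
        ((UniversalEnvelopingAlgebra.ι ℂ : A ⊗[ℂ] Tau κ →ₗ⁅ℂ⁆ Env κ A).toLinearMap -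
          (Algebra.linearMap ℂ (Env κ A)) ∘ₗ ψ ∘ₗ π.lTensor A) := by
      refine current_le.mpr fun a x hx => Submodule.subset_span (Or.inr ⟨a, ⟨x, hx⟩, ?_⟩)
      have : π x = ⟨x, hx⟩ := hπ ⟨x, hx⟩
      simp [elt, this]
    rw [h0] at hx
    exact this hx

theorem isHighestWeight_irrHW (h0 : grade ((1 : A) ⊗ₜ[ℂ] d) 0 = current A (hbar κ H))
    (hpos : ∀ k, 0 < k → grade ((1 : A) ⊗ₜ[ℂ] d) k ≤ current A (tauPos κ H b))
    (hπ : ∀ h : hbar κ H, π h = h) :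
    IsHighestWeight ((1 : A) ⊗ₜ[ℂ] d) (ψ ∘ₗ π.lTensor A) (highestWeightVector b ψ) :=
  (isHighestWeight_verma h0 hpos hπ).quotient _

end

/-- `ψ ∘ π` is a character of `τ⁰(A) ⊕ τ⁺(A)` because `𝔥̄(A)` is abelian and `π` kills `τ⁺`. The
induced functional on `M(ψ)` then separates the generator from the maximal submodule. -/
theorem highestWeightVector_ne_zero : highestWeightVector b ψ ≠ 0 := by
  obtain ⟨d, hdh, hd, h0, hpos, hpos', -, -, π, hπ, hπ0⟩ := exists_triangular_grading A κ b
  have h := isHighestWeight_verma (ψ := ψ) h0 hpos hπ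
  have hχ : current A (tauPos κ H b) ≤ LinearMap.ker (ψ ∘ₗ π.lTensor A) :=
    current_le.mpr fun a x hx => by simp [hπ0 x hx]
  have hlie : ∀ x ∈ current A (hbar κ H), ∀ y ∈ current A (hbar κ H), ⁅x, y⁆ = 0 := by
    intro x hx y hy
    have h1 : current A (hbar κ H) ≤
        LinearMap.ker ((LieAlgebra.ad ℂ (A ⊗[ℂ] Tau κ) : _ →ₗ[ℂ] Module.End ℂ _).flip y) := by
      refine current_le.mpr fun a h hh => ?_
      have h2 : current A (hbar κ H) ≤
          LinearMap.ker (LieAlgebra.ad ℂ (A ⊗[ℂ] Tau κ) (a ⊗ₜ[ℂ] h)) := by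
        refine current_le.mpr fun c h' hh' => ?_
        rw [LinearMap.mem_ker, LieAlgebra.ad_apply, LieAlgebra.ExtendScalars.bracket_tmul,
          lie_eq_zero_of_mem_hbar hh hh', TensorProduct.tmul_zero]
      exact h2 hy
    exact h1 hx
  obtain ⟨ε, hε, hneg⟩ := exists_functional_quotient (χ := ψ ∘ₗ π.lTensor A) hd
    (fun k hk x hx => hχ (hpos k hk hx))
    (fun x hx y hy => by rw [hlie x (h0 ▸ hx) y (h0 ▸ hy), map_zero])
    (T := ({u | ∃ a : A, ∃ x ∈ tauPos κ H b, u = elt κ a x} ∪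
      {u | ∃ (a : A) (h : hbar κ H),
        u = elt κ a (h : Tau κ) - algebraMap ℂ (Env κ A) (ψ (a ⊗ₜ h))})) (by
      rintro _ (⟨a, x, hx, rfl⟩ | ⟨a, h, rfl⟩)
      · refine ⟨a ⊗ₜ x, ?_, ?_⟩
        · exact (iSup₂_le fun k hk => le_iSup₂_of_le k hk.le le_rfl :
            (⨆ k : ℤ, ⨆ _ : 0 < k, grade ((1 : A) ⊗ₜ[ℂ] d) k) ≤ _) (hpos' (tmul_mem_current a hx))
        · rw [show (ψ ∘ₗ π.lTensor A) (a ⊗ₜ x) = 0 from hχ (tmul_mem_current a hx), map_zero,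
            sub_zero]
          rfl
      · refine ⟨a ⊗ₜ (h : Tau κ), ?_, ?_⟩
        · exact Submodule.mem_iSup_of_mem 0 (Submodule.mem_iSup_of_mem le_rfl
            (h0 ▸ tmul_mem_current a h.2))
        · simp [hπ, elt])
  exact h.mk_sSup_ne_zero hd hε hneg

/-- If `ψ` vanishes on `𝔥̄(I)`, then `τ(I)` acts trivially on `V(ψ)`. -/
theorem lieAct_irrHW_eq_zero {I : Ideal A} (hI : ∀ a ∈ I, ∀ h : hbar κ H, ψ (a ⊗ₜ h) = 0) {a : A}
    (ha : a ∈ I) (x : Tau κ) (w : IrrHW b ψ) : lieAct (IrrHW b ψ) (a ⊗ₜ[ℂ] x) w = 0 := by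
  obtain ⟨d, -, hd, h0, hpos, -, -, hgr, π, hπ, -⟩ := exists_triangular_grading A κ b
  refine (isHighestWeight_irrHW h0 hpos hπ).lieAct_eq_zero_of_mem_ideal hd eq_bot_of_ne_top_irrHW
    (currentIdeal (Tau κ) I) (hgr I) (fun y hy _ => ?_) (tmul_mem_currentIdeal ha x) w
  have : (currentIdeal (Tau κ) I).toSubmodule ≤ LinearMap.ker (ψ ∘ₗ π.lTensor A) :=
    currentIdeal_le fun c hc z => by simp [hI c hc]
  exact this hy

/-- A weight space lies in an eigenspace of the single element `d ∈ 𝔥̄`, and those are already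
finite-dimensional. -/
theorem finiteDimensional_weightSpace {I : Ideal A} [FiniteDimensional ℂ (A ⧸ I)]
    (hI : ∀ a ∈ I, ∀ h : hbar κ H, ψ (a ⊗ₜ h) = 0) (μ : hbar κ H →ₗ[ℂ] ℂ) :
    FiniteDimensional ℂ (weightSpace b ψ μ) := by
  obtain ⟨d, hdh, hd, h0, hpos, -, hfg, -, π, hπ, -⟩ := exists_triangular_grading A κ b
  have hfin : ∀ i : ℤ, 0 < i → FiniteDimensional ℂ
      ((grade ((1 : A) ⊗ₜ[ℂ] d) (-i)).map (lieAct (IrrHW b ψ))) := by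
    intro i _
    obtain ⟨W, hW, hle⟩ := hfg (-i)
    have h1 := fg_map_lieAct_current (V := IrrHW b ψ) I
      (fun a ha x => LinearMap.ext fun w => lieAct_irrHW_eq_zero hI ha x w) hW
    have := (Submodule.fg_iff_finiteDimensional _).mp h1
    exact Submodule.finiteDimensional_of_le (Submodule.map_mono hle)
  have := (isHighestWeight_irrHW (ψ := ψ) h0 hpos hπ).finiteDimensional_eigenspace hd hfin
    (μ ⟨d, hdh⟩)
  refine Submodule.finiteDimensional_of_le (S₂ := (lieAct (IrrHW b ψ)
    ((1 : A) ⊗ₜ[ℂ] d)).eigenspace (μ ⟨d, hdh⟩)) fun w hw => ?_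
  exact Module.End.mem_eigenspace_iff.mpr (hw ⟨d, hdh⟩)

end LoopGrading

/-! ### From finite-dimensional weight spaces to a co-finite ideal -/

section CofiniteIdeal

set_option linter.unusedSectionVars false

open LieAlgebra LieAlgebra.IsKilling LieModule

theorem finiteDimensional_quotient_inf {A : Type*} [CommRing A] [Algebra ℂ A] (I J : Ideal A)
    [FiniteDimensional ℂ (A ⧸ I)] [FiniteDimensional ℂ (A ⧸ J)] :
    FiniteDimensional ℂ (A ⧸ I ⊓ J) := by
  let f : A →ₗ[ℂ] (A ⧸ I) × (A ⧸ J) :=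
    (Ideal.Quotient.mkₐ ℂ I).toLinearMap.prod (Ideal.Quotient.mkₐ ℂ J).toLinearMap
  have hf : LinearMap.ker f = (I ⊓ J).restrictScalars ℂ := by
    ext a
    simp [f, Ideal.Quotient.eq_zero_iff_mem]
  have h1 : FiniteDimensional ℂ (A ⧸ LinearMap.ker f) :=
    f.quotKerEquivRange.symm.finiteDimensional
  rw [hf] at h1
  exact h1

variable {A : Type*} [CommRing A] [Algebra ℂ A]
  {𝔤 : Type*} [LieRing 𝔤] [LieAlgebra ℂ 𝔤] [FiniteDimensional ℂ 𝔤] [LieAlgebra.IsSimple ℂ 𝔤]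
  {κ : InvariantForm 𝔤} {H : LieSubalgebra ℂ 𝔤} [H.IsCartanSubalgebra]
  {b : (rootSystem H).Base} {ψ : A ⊗[ℂ] hbar κ H →ₗ[ℂ] ℂ}

theorem lieAct_highestWeightVector_of_mem_hbar (a : A) (h : hbar κ H) :
    lieAct (IrrHW b ψ) (a ⊗ₜ[ℂ] (h : Tau κ)) (highestWeightVector b ψ) =
      ψ (a ⊗ₜ h) • highestWeightVector b ψ := by
  obtain ⟨d, -, hd, h0, hpos, -, -, -, π, hπ, -⟩ := exists_triangular_grading A κ b
  have := (isHighestWeight_irrHW (ψ := ψ) h0 hpos hπ).zero _ (h0 ▸ tmul_mem_current a h.2)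
  simpa [hπ] using this

theorem lieAct_highestWeightVector_of_mem_tauPos (a : A) {x : Tau κ} (hx : x ∈ tauPos κ H b) :
    lieAct (IrrHW b ψ) (a ⊗ₜ[ℂ] x) (highestWeightVector b ψ) = 0 := by
  have hmem : elt κ a x ∈ vermaIdeal b ψ := Submodule.subset_span (Or.inl ⟨a, x, hx, rfl⟩)
  have : elt κ a x • (Submodule.Quotient.mk 1 : Verma b ψ) = 0 := by
    rw [← Submodule.Quotient.mk_smul, smul_eq_mul, mul_one]
    exact (Submodule.Quotient.mk_eq_zero _).mpr hmem
  rw [← elt_smul_eq_lieAct, highestWeightVector, ← Submodule.Quotient.mk_smul, this,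
    Submodule.Quotient.mk_zero]

/-- The annihilator of the highest weight vector in a root line `y(A)` is an ideal, it is co-finite
if the weight spaces are finite-dimensional, and `ψ` vanishes on its multiples of `[x, y] ∈ 𝔥̄`. -/
theorem exists_cofinite_ideal_of_weight_vector
    (hfin : ∀ μ : hbar κ H →ₗ[ℂ] ℂ, FiniteDimensional ℂ (weightSpace b ψ μ))
    {x y : Tau κ} (hx : x ∈ tauPos κ H b) (hy : ∀ h ∈ hbar κ H, ∃ c : ℂ, ⁅h, y⁆ = c • y)
    {h₀ : Tau κ} (hh₀ : h₀ ∈ hbar κ H) {c₀ : ℂ} (hc₀ : c₀ ≠ 0) (hy₀ : ⁅h₀, y⁆ = c₀ • y)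
    (z : hbar κ H) (hxy : ⁅x, y⁆ = z) :
    ∃ I : Ideal A, FiniteDimensional ℂ (A ⧸ I) ∧ ∀ a ∈ I, ψ (a ⊗ₜ z) = 0 := by
  set v := highestWeightVector b ψ with hv
  let V := IrrHW b ψ
  have hcomm : ∀ (a c : A) (h : hbar κ H) (e : ℂ), ⁅(h : Tau κ), y⁆ = e • y →
      lieAct V (c ⊗ₜ[ℂ] (h : Tau κ)) (lieAct V (a ⊗ₜ[ℂ] y) v) =
        e • lieAct V ((c * a) ⊗ₜ[ℂ] y) v + ψ (c ⊗ₜ h) • lieAct V (a ⊗ₜ[ℂ] y) v := by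
    intro a c h e he
    have h1 := lieAct_lie (V := V) (c ⊗ₜ[ℂ] (h : Tau κ)) (a ⊗ₜ[ℂ] y) v
    rw [LieAlgebra.ExtendScalars.bracket_tmul, he, TensorProduct.tmul_smul, map_smul,
      LinearMap.smul_apply, lieAct_highestWeightVector_of_mem_hbar, map_smul, eq_sub_iff_add_eq]
      at h1
    exact h1.symm
  let f : A →ₗ[ℂ] V :=
    (lieAct V).flip v ∘ₗ (TensorProduct.mk ℂ A (Tau κ)).flip y
  have hf : ∀ a, f a = lieAct V (a ⊗ₜ[ℂ] y) v := fun a => rfl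
  -- Acting by `c ⊗ h₀` on `f a = 0` gives `c₀ • f (c * a) = 0`; this is where `c₀ ≠ 0` enters.
  have hker : ∀ a c, f a = 0 → f (c * a) = 0 := by
    intro a c ha
    have h1 := hcomm a c ⟨h₀, hh₀⟩ c₀ hy₀
    rw [← hf, ha, map_zero, smul_zero, add_zero, eq_comm, smul_eq_zero] at h1
    exact h1.resolve_left hc₀
  let I : Ideal A :=
    { carrier := {a | f a = 0}
      add_mem' := fun {a c} ha hc => by
        change f (a + c) = 0
        rw [map_add, ha, hc, add_zero]
      zero_mem' := map_zero f
      smul_mem' := fun c a ha => hker a c ha }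
  refine ⟨I, ?_, fun a ha => ?_⟩
  · have hrange : FiniteDimensional ℂ (LinearMap.range f) := by
      by_cases hy0 : y = 0
      · have : f = 0 := LinearMap.ext fun a => by
          rw [hf, hy0, TensorProduct.tmul_zero, map_zero, LinearMap.zero_apply, LinearMap.zero_apply]
        rw [this, LinearMap.range_zero]
        infer_instance
      · obtain ⟨φ, hφ⟩ := Module.Projective.exists_dual_ne_zero ℂ hy0
        -- `hy` gives an eigenvalue for each `h` separately; a functional with `φ y ≠ 0` recovers it
        -- linearly in `h`, so the range of `f` lies in one weight space.
        let ν : hbar κ H →ₗ[ℂ] ℂ :=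
          (φ y)⁻¹ • (φ ∘ₗ (LieAlgebra.ad ℂ (Tau κ) : _ →ₗ[ℂ] Module.End ℂ _).flip y ∘ₗ
            (hbar κ H).subtype)
        have hν : ∀ h : hbar κ H, ⁅(h : Tau κ), y⁆ = ν h • y := by
          intro h
          obtain ⟨c, hc⟩ := hy h h.2
          have : ν h = (φ y)⁻¹ * φ ⁅(h : Tau κ), y⁆ := rfl
          rw [this, hc, map_smul, smul_eq_mul, mul_left_comm, inv_mul_cancel₀ hφ, mul_one]
        have := hfin (ν + ψ ∘ₗ TensorProduct.mk ℂ A (hbar κ H) 1)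
        refine Submodule.finiteDimensional_of_le (S₂ := weightSpace b ψ
          (ν + ψ ∘ₗ TensorProduct.mk ℂ A (hbar κ H) 1)) ?_
        rintro _ ⟨a, rfl⟩ h
        rw [hf, elt_smul_eq_lieAct, hcomm a 1 h _ (hν h), one_mul, ← add_smul]
        rfl
    have hI : LinearMap.ker f = I.restrictScalars ℂ := rfl
    have h1 : FiniteDimensional ℂ (A ⧸ LinearMap.ker f) :=
      f.quotKerEquivRange.symm.finiteDimensional
    rw [hI] at h1
    exact h1
  -- Since `x` kills `v` and `(a ⊗ y) v = 0`, also `(a ⊗ [x, y]) v = 0`, and `v ≠ 0` gives the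
  -- vanishing of `ψ`.
  · have h1 := lieAct_lie (V := V) ((1 : A) ⊗ₜ[ℂ] x) (a ⊗ₜ[ℂ] y) v
    rw [LieAlgebra.ExtendScalars.bracket_tmul, one_mul, hxy,
      lieAct_highestWeightVector_of_mem_hbar, lieAct_highestWeightVector_of_mem_tauPos _ hx,
      map_zero, sub_zero, show lieAct V (a ⊗ₜ[ℂ] y) v = 0 from ha, map_zero, smul_eq_zero] at h1
    exact h1.resolve_right highestWeightVector_ne_zero

variable (ψ) in
/-- The elements of `𝔥̄` at which `ψ` is killed by a co-finite ideal. -/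
def cofiniteSubmodule : Submodule ℂ (hbar κ H) where
  carrier := {h | ∃ I : Ideal A, FiniteDimensional ℂ (A ⧸ I) ∧ ∀ a ∈ I, ψ (a ⊗ₜ h) = 0}
  add_mem' := by
    rintro h h' ⟨I, hI, hψ⟩ ⟨J, hJ, hψ'⟩
    refine ⟨I ⊓ J, finiteDimensional_quotient_inf I J, fun a ha => ?_⟩
    rw [TensorProduct.tmul_add, map_add, hψ a ha.1, hψ' a ha.2, add_zero]
  zero_mem' := ⟨⊤, inferInstance, fun a _ => by rw [TensorProduct.tmul_zero, map_zero]⟩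
  smul_mem' := by
    rintro c h ⟨I, hI, hψ⟩
    exact ⟨I, hI, fun a ha => by rw [TensorProduct.tmul_smul, map_smul, hψ a ha, smul_zero]⟩

/-- The ideal attached to an element of `𝔥̄` depends on that element; as `𝔥̄` is finite-dimensional,
intersecting the ideals of a finite spanning set serves all of them. -/
theorem exists_cofinite_ideal_of_cofiniteSubmodule_eq_top (h : cofiniteSubmodule ψ = ⊤) :
    ∃ I : Ideal A, FiniteDimensional ℂ (A ⧸ I) ∧ ∀ a ∈ I, ∀ h : hbar κ H, ψ (a ⊗ₜ h) = 0 := by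
  have hfg : (⊤ : Submodule ℂ (hbar κ H)).FG := (Submodule.fg_top _).mpr fg_hbar
  obtain ⟨S, hS⟩ := hfg
  have key : ∃ I : Ideal A, FiniteDimensional ℂ (A ⧸ I) ∧ ∀ s ∈ S, ∀ a ∈ I, ψ (a ⊗ₜ s) = 0 := by
    clear hS
    induction S using Finset.cons_induction with
    | empty => exact ⟨⊤, inferInstance, fun s hs => absurd hs (Finset.notMem_empty s)⟩
    | cons s S hs ih =>
      obtain ⟨I, hI, hψ⟩ := ih
      obtain ⟨J, hJ, hψ'⟩ := (h ▸ Submodule.mem_top : s ∈ cofiniteSubmodule ψ)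
      refine ⟨I ⊓ J, finiteDimensional_quotient_inf I J, fun t ht a ha => ?_⟩
      rcases Finset.mem_cons.mp ht with rfl | ht
      · exact hψ' a ha.2
      · exact hψ t ht a ha.1
  obtain ⟨I, hI, hψ⟩ := key
  refine ⟨I, hI, fun a ha h => ?_⟩
  have hle : Submodule.span ℂ (S : Set (hbar κ H)) ≤
      LinearMap.ker (ψ ∘ₗ TensorProduct.mk ℂ A (hbar κ H) a) :=
    Submodule.span_le.mpr fun s hs => hψ s hs a ha
  exact hle (hS ▸ Submodule.mem_top)

/-- The form is non-degenerate on the Cartan subalgebra. -/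
theorem exists_form_ne_zero (κ : InvariantForm 𝔤) (H : LieSubalgebra ℂ 𝔤) [H.IsCartanSubalgebra] :
    ∃ h h' : H, κ.form h h' ≠ 0 := by
  have hH : ∃ h : H, (h : 𝔤) ≠ 0 := by
    by_contra! hcon
    have := nontrivial_of_isSimple 𝔤
    obtain ⟨x, hx⟩ := exists_ne (0 : 𝔤)
    -- A zero subalgebra is normalised by everything, whereas `H` is its own normaliser.
    have hxH : x ∈ H := by
      rw [← LieSubalgebra.IsCartanSubalgebra.self_normalizing (H := H),
        LieSubalgebra.mem_normalizer_iff]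
      intro y hy
      rw [show y = 0 from hcon ⟨y, hy⟩, lie_zero]
      exact H.zero_mem
    exact hx (hcon ⟨x, hxH⟩)
  obtain ⟨h, hh⟩ := hH
  by_contra! hcon
  refine hh (κ.nondegenerate.1 h fun y => ?_)
  have hle : (⊤ : Submodule ℂ 𝔤) ≤ LinearMap.ker (κ.form h) := by
    rw [← iSup_rootSpace (H := H), iSup_le_iff]
    intro α x hx
    rw [LinearMap.mem_ker]
    by_cases hα : α.IsZero
    · have h0 : rootSpace H α = rootSpace H 0 := congrArg (rootSpace H) hα
      rw [h0, rootSpace_zero_eq] at hx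
      exact hcon h ⟨x, hx⟩
    -- `𝔥` is orthogonal to `𝔤_α`: `α(h') (h, x) = (h, [h', x]) = ([h, h'], x) = 0` with `α(h') ≠
    -- 0`.
    · obtain ⟨h', hh'⟩ := Function.ne_iff.mp hα
      have h1 : ⁅(h' : 𝔤), x⁆ = α h' • x := lie_eq_smul_of_mem_rootSpace hx h'
      have h2 := κ.invariant h h' x
      rw [h1, map_smul, show ⁅(h : 𝔤), (h' : 𝔤)⁆ = 0 from
        congrArg Subtype.val (trivial_lie_zero H H h h'), map_zero, LinearMap.zero_apply, eq_comm,
        smul_eq_zero] at h2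
      exact h2.resolve_left hh'
  exact hle Submodule.mem_top

theorem X_mem_hbar (h : H) : Tau.X κ 0 (h : 𝔤) ∈ hbar κ H :=
  Submodule.mem_sup_left (Submodule.mem_map_of_mem h.2)

theorem L_mem_hbar : Tau.L κ 0 ∈ hbar κ H :=
  Submodule.mem_sup_right (Submodule.subset_span (by simp))

theorem K_mem_hbar : Tau.K κ ∈ hbar κ H :=
  Submodule.mem_sup_right (Submodule.subset_span (by simp))

theorem exists_lie_X_eq_smul {y : 𝔤} (hy : ∀ h : H, ∃ c : ℂ, ⁅(h : 𝔤), y⁆ = c • y) (n : ℤ) :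
    ∀ h ∈ hbar κ H, ∃ c : ℂ, ⁅h, Tau.X κ n y⁆ = c • Tau.X κ n y := by
  intro h hh
  obtain ⟨h, c, e, rfl⟩ := exists_eq_of_mem_hbar hh
  obtain ⟨β, hβ⟩ := hy h
  refine ⟨β + e * n, ?_⟩
  rw [add_lie, add_lie, smul_lie, smul_lie, Tau.X_bracket_X, Tau.K_bracket, Tau.L_bracket_X, hβ]
  by_cases hn : n = 0
  · simp [hn]
  · simp [hn, add_smul, mul_smul]

/-- If the weight spaces of `V(ψ)` are finite-dimensional, then `ψ` vanishes on `𝔥̄(I)` for a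
co-finite ideal `I`. -/
theorem exists_cofinite_ideal_of_finiteDimensional
    (hfin : ∀ μ : hbar κ H →ₗ[ℂ] ℂ, FiniteDimensional ℂ (weightSpace b ψ μ)) :
    ∃ I : Ideal A, FiniteDimensional ℂ (A ⧸ I) ∧ ∀ a ∈ I, ∀ h : hbar κ H, ψ (a ⊗ₜ h) = 0 := by
  refine exists_cofinite_ideal_of_cofiniteSubmodule_eq_top ?_
  have hL : (⟨Tau.L κ 0, L_mem_hbar⟩ : hbar κ H) ∈ cofiniteSubmodule ψ := by
    -- `[L₁, L₋₁] = -2 L₀`: the central term `(n³ - n) / 12` vanishes at `n = 1`.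
    have hmem : ((-2 : ℂ) • ⟨Tau.L κ 0, L_mem_hbar⟩ : hbar κ H) ∈ cofiniteSubmodule ψ := by
      refine exists_cofinite_ideal_of_weight_vector hfin (x := Tau.L κ 1) (y := Tau.L κ (-1))
        (Submodule.mem_sup_right (Submodule.subset_span ⟨1, one_pos, rfl⟩)) ?_ L_mem_hbar
        (c₀ := -1) (by norm_num) ?_ _ ?_
      · intro h hh
        obtain ⟨h, c, e, rfl⟩ := exists_eq_of_mem_hbar hh
        exact ⟨-e, by
          simp [Tau.X_bracket_L, Tau.K_bracket, Tau.L_bracket_L]⟩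
      · simp [Tau.L_bracket_L]
      · rw [Tau.L_bracket_L]
        norm_num
    have := Submodule.smul_mem _ (-2 : ℂ)⁻¹ hmem
    rwa [smul_smul, inv_mul_cancel₀ (by norm_num), one_smul] at this
  have hK : (⟨Tau.K κ, K_mem_hbar⟩ : hbar κ H) ∈ cofiniteSubmodule ψ := by
    obtain ⟨h, h', hne⟩ := exists_form_ne_zero κ H
    have hzero : ∀ h h' : H, ⁅(h : 𝔤), (h' : 𝔤)⁆ = 0 := fun h h' =>
      congrArg Subtype.val (trivial_lie_zero H H h h')
    -- `[h ⊗ t, h' ⊗ t⁻¹] = -(h, h') K`, because `𝔥` is abelian and the cocycle carries the exponent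
    -- of the second factor.
    have hmem : ((-κ.form h h') • ⟨Tau.K κ, K_mem_hbar⟩ : hbar κ H) ∈ cofiniteSubmodule ψ := by
      refine exists_cofinite_ideal_of_weight_vector hfin (x := Tau.X κ 1 (h : 𝔤))
        (y := Tau.X κ (-1) (h' : 𝔤)) ?_ (exists_lie_X_eq_smul ?_ _) L_mem_hbar
        (c₀ := -1) (by norm_num) ?_ _ ?_
      · exact Submodule.mem_sup_left (Submodule.mem_sup_right
          (Submodule.mem_iSup_of_mem 1 (Submodule.mem_iSup_of_mem one_pos ⟨_, rfl⟩)))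
      · exact fun h => ⟨0, by rw [hzero, zero_smul]⟩
      · simp [Tau.L_bracket_X]
      · simp [Tau.X_bracket_X, hzero]
    have := Submodule.smul_mem _ (-κ.form h h')⁻¹ hmem
    rwa [smul_smul, inv_mul_cancel₀ (neg_ne_zero.mpr hne), one_smul] at this
  have hX : ∀ h : H, (⟨Tau.X κ 0 (h : 𝔤), X_mem_hbar h⟩ : hbar κ H) ∈ cofiniteSubmodule ψ := by
    let g : H →ₗ[ℂ] hbar κ H :=
      (Tau.X κ 0 ∘ₗ H.toSubmodule.subtype).codRestrict (hbar κ H) fun h => X_mem_hbar h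
    -- The simple coroots span `𝔥`. Each is `[e, f]` for an `sl₂`-triple with `e ∈ 𝔫⁺`, and it acts
    -- on `f` by `-2`.
    have hle : (⊤ : Submodule ℂ H) ≤ (cofiniteSubmodule ψ).comap g := by
      have hspan := b.span_coroot_support
      rw [RootPairing.corootSpan, RootPairing.IsRootSystem.span_coroot_eq_top] at hspan
      rw [← hspan, Submodule.span_le]
      rintro _ ⟨α, hα, rfl⟩
      have hα0 : (α : Weight ℂ H 𝔤).IsNonZero := LieSubalgebra.isNonZero_coe_root α
      obtain ⟨t, e, f, hsl, he, hf⟩ := exists_isSl2Triple_of_weight_isNonZero hα0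
      have ht := hsl.h_eq_coroot hα0 he hf
      have hroot : ∀ h : H, ⁅(h : 𝔤), f⁆ = (-(α : Weight ℂ H 𝔤) h) • f := fun h =>
        lie_eq_smul_of_mem_rootSpace hf h
      refine exists_cofinite_ideal_of_weight_vector hfin (x := Tau.X κ 0 e) (y := Tau.X κ 0 f)
        ?_ (exists_lie_X_eq_smul (fun h => ⟨_, hroot h⟩) 0)
        (X_mem_hbar (coroot (α : Weight ℂ H 𝔤))) (c₀ := -2) (by norm_num) ?_ _ ?_
      · refine Submodule.mem_sup_left (Submodule.mem_sup_left (Submodule.mem_map_of_mem ?_))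
        exact Submodule.mem_iSup_of_mem α (Submodule.mem_iSup_of_mem
          (RootPairing.Base.isPos_of_mem_support hα) he)
      · rw [Tau.X_bracket_X, hroot, root_apply_coroot hα0]
        simp
      · rw [Tau.X_bracket_X, hsl.lie_e_f, ht]
        simp only [Int.cast_zero, zero_mul, ite_self, zero_smul, add_zero]
        rfl
    exact fun h => hle (Submodule.mem_top (x := h))
  refine Submodule.eq_top_iff'.mpr fun z => ?_
  obtain ⟨h, c, e, hz⟩ := exists_eq_of_mem_hbar z.2
  have : z = ⟨Tau.X κ 0 (h : 𝔤), X_mem_hbar h⟩ +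
      (c • ⟨Tau.K κ, K_mem_hbar⟩ + e • ⟨Tau.L κ 0, L_mem_hbar⟩) := Subtype.ext hz
  rw [this]
  exact add_mem (hX h) (add_mem (Submodule.smul_mem _ c hK) (Submodule.smul_mem _ e hL))

end CofiniteIdeal

end LoopAffineVirasoro

end

theorem proposition1p1
    {𝔤 : Type*} [LieRing 𝔤] [LieAlgebra ℂ 𝔤] [FiniteDimensional ℂ 𝔤] [LieAlgebra.IsSimple ℂ 𝔤]
    (κ : LoopAffineVirasoro.InvariantForm 𝔤)
    (H : LieSubalgebra ℂ 𝔤) [H.IsCartanSubalgebra]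
    (b : (LieAlgebra.IsKilling.rootSystem H).Base)
    {A : Type*} [CommRing A] [Algebra ℂ A] [Algebra.FiniteType ℂ A]
    (ψ : A ⊗[ℂ] LoopAffineVirasoro.hbar κ H →ₗ[ℂ] ℂ) :
    ((∀ μ : LoopAffineVirasoro.hbar κ H →ₗ[ℂ] ℂ,
        FiniteDimensional ℂ (LoopAffineVirasoro.weightSpace b ψ μ)) ↔
      ∃ I : Ideal A, FiniteDimensional ℂ (A ⧸ I) ∧
        ∀ a ∈ I, ∀ h : LoopAffineVirasoro.hbar κ H, ψ (a ⊗ₜ h) = 0) ∧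
    (∀ I : Ideal A, FiniteDimensional ℂ (A ⧸ I) →
      (∀ a ∈ I, ∀ h : LoopAffineVirasoro.hbar κ H, ψ (a ⊗ₜ h) = 0) →
      ∀ a ∈ I, ∀ (x : LoopAffineVirasoro.Tau κ) (v : LoopAffineVirasoro.IrrHW b ψ),
        LoopAffineVirasoro.elt κ a x • v = 0) := by
  refine ⟨⟨LoopAffineVirasoro.exists_cofinite_ideal_of_finiteDimensional, ?_⟩, ?_⟩
  · rintro ⟨I, hI, hψ⟩ μ
    exact LoopAffineVirasoro.finiteDimensional_weightSpace hψ μ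
  · intro I _ hψ a ha x v
    exact LoopAffineVirasoro.lieAct_irrHW_eq_zero hψ ha x v
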